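/- Let $n\ge 1$, let $r=(r_1,\dots,r_n)\in\mathbb Z_{\ge1}^n$, and put $N=r_1+\cdots+r_n$ and $r!=r_1!\cdots r_n!$. Let $B_k$ and $B_k(x)$ be the Bernoulli numbers and polynomials, given by $\frac{ze^{xz}}{e^z-1}=\sum_{k\ge0}B_k(x)\frac{z^k}{k!}$ and $B_k=B_k(0)$. Let $\widetilde B_k$ be the function of period $1$ that agrees with $B_k(x)$ on $[0,1)$, except that $\widetilde B_1(0)=0$. For an integer $q\ge1$ and integers $p_1,\dots,p_{n-1}$ with $\gcd(p_i,q)=1$ for every $i$, define the generalized Dedekind sum $$s_r(q;p_1,\dots,p_{n-1})=\sum_{k_1,\dots,k_{n-1}\in\mathbb Z/q\mathbb Z}\widetilde B_{r_1}\!\left(\tfrac{k_1}{q}\right)\cdots\widetilde B_{r_{n-1}}\!\left(\tfrac{k_{n-1}}{q}\right)\widetilde B_{r_n}\!\left(\tfrac{p_1k_1+\cdots+p_{n-1}k_{n-1}}{q}\right)$$ (so $s_r(q)=\widetilde B_{r_1}(0)$ if $n=1$). Let $d=d_{N,n}$ be the least common multiple of the denominators of the coefficients of the $N$-th Todd polynomial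 in $n$ variables, that is, of the homogeneous part of total degree $N$ of the power series $\prod_{i=1}^n\frac{x_i}{1-e^{-x_i}}$. Then $$\frac{d\,q^{N-n+1}}{r!}\,s_r(q;p_1,\dots,p_{n-1})\in\mathbb Z,$$ and, with $p_n=-1$, $$\frac{d\,q^{N-n+1}}{r!}\,s_r(q;p_1,\dots,p_{n-1})\equiv\sum_{m}(-d)\prod_{i=1}^n\frac{B_{m_i}}{m_i!}\binom{m_i-1}{r_i-1}p_i^{\,m_i-r_i}\pmod q,$$ where the sum is over all $n$-tuples $m=(m_1,\dots,m_n)$ of nonnegative even integers with $m_1+\cdots+m_n=N$ and at least one $m_i=0$. Here $\binom{-1}{k}=(-1)^k$, and for $e<0$ the power $p_i^{e}$ means $(p_i')^{-e}$ for an integer $p_i'$ with $p_ip_i'\equiv1\pmod q$ (with $p_n'=-1$); for every such choice of the $p_i'$ the right-hand side is an integer, and the congruence holds. -/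

import Mathlib

/-- The classical Todd series in one variable, `∑ B_i / i! * (-z)^i`. -/
noncomputable def toddSeries : PowerSeries ℚ :=
  PowerSeries.mk fun i => bernoulli i / (i.factorial : ℚ) * (-1) ^ i

/-- The Todd series is `z / (1 - exp (-z))`. -/
theorem toddSeries_mul :
    toddSeries * (1 - PowerSeries.evalNegHom (PowerSeries.exp ℚ)) = PowerSeries.X := by
  have h1 : toddSeries = PowerSeries.evalNegHom (bernoulliPowerSeries ℚ) := by
    ext i
    simp [toddSeries, bernoulliPowerSeries, PowerSeries.evalNegHom, PowerSeries.coeff_rescale,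
      mul_comm]
  have h2 := congrArg PowerSeries.evalNegHom (bernoulliPowerSeries_mul_exp_sub_one ℚ)
  rw [map_mul, map_sub, map_one, ← h1, PowerSeries.evalNegHom_X] at h2
  rw [← neg_sub, mul_neg, h2, neg_neg]

/-- The `N`-th Todd polynomial in `n` variables: the homogeneous part of total degree `N` of the
power series `∏ i, x_i / (1 - exp (-x_i))`. -/
noncomputable def toddPolynomial (n N : ℕ) : MvPolynomial (Fin n) ℚ :=
  ∑ m ∈ Finset.piAntidiag (Finset.univ : Finset (Fin n)) N,
    MvPolynomial.monomial (Finsupp.equivFunOnFinite.symm m)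
      (∏ i, PowerSeries.coeff (m i) toddSeries)

/-- `d_{N,n}`: the least common multiple of the denominators of the coefficients of the `N`-th Todd
polynomial in `n` variables. -/
noncomputable def toddDenominator (N n : ℕ) : ℕ :=
  (toddPolynomial n N).support.lcm fun m => ((toddPolynomial n N).coeff m).den

/-- The `k`-th periodic Bernoulli function at rational arguments: it has period `1`, and on `[0, 1)`
it equals the Bernoulli polynomial `B_k`, except that the first one vanishes at `0`. -/
noncomputable def periodicBernoulli (k : ℕ) (t : ℚ) : ℚ :=
  if k = 1 ∧ Int.fract t = 0 then 0 else (Polynomial.bernoulli k).eval (Int.fract t)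

/-- The generalized Dedekind sum `s_r(q; p_1, …, p_n)` in dimension `n + 1`. -/
noncomputable def generalizedDedekindSum {n : ℕ} (r : Fin (n + 1) → ℕ) (q : ℕ) (p : Fin n → ℤ) : ℚ :=
  ∑ k : Fin n → Fin q,
    (∏ i : Fin n, periodicBernoulli (r i.castSucc) (((k i : ℕ) : ℚ) / (q : ℚ))) *
      periodicBernoulli (r (Fin.last n))
        ((∑ i : Fin n, (p i : ℚ) * ((k i : ℕ) : ℚ)) / (q : ℚ))

/-- The power `a ^ e` with an integer exponent `e`, where the integer `b` stands for an inverse of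
`a` (modulo some `q`) and is used for negative exponents. -/
def powWithInverse (a b e : ℤ) : ℤ :=
  if 0 ≤ e then a ^ e.toNat else b ^ (-e).toNat

/-- The tuples `(m_1, …, m_n)` of nonnegative even integers with sum `N` and at least one zero
coordinate. -/
def evenIndices (n N : ℕ) : Finset (Fin n → ℕ) :=
  (Finset.piAntidiag Finset.univ N).filter fun m => (∀ i, Even (m i)) ∧ ∃ i, m i = 0

/-!
The normalized Dedekind sums are the Laurent coefficients of
`∏ i, cothFun (w ^ P i * exp (x i * z))`, where `cothFun u = (u + 1) / (2 * (u - 1))`, summed over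
the `Q`-th roots of unity `w`, because the finite Fourier transforms of the periodic Bernoulli
functions are coefficients of `cothFun (w * exp z)`. The residue theorem for
`∏ j, cothFun (w ^ P j * u j) * dw / w` gives a reciprocity law that relates the modulus `Q` to the
moduli `P i`; up to terms that the Todd denominator clears, it is Euclid's algorithm.

At a prime `ℓ` that does not divide `Q`, integrality follows by strong induction on `Q`: reduce the
`P i` modulo `Q`, changing the sign of those that become divisible by `ℓ`, and apply the reciprocity
law. The variables `x i` are algebraically independent, the law is read in the localization of
`ℤ[x]` at `ℓ`, and Gauss's lemma extracts the coefficients.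

At a prime `ℓ` that divides `q`, all `P i` are prime to `ℓ` and one application of reciprocity
suffices. Modulo `q`, it leaves only indices with a zero coordinate, and the residue theorem for
`∏ i, (P i * T + x i) ^ (m i - 1) / T`, a partial fraction expansion, turns their contribution into
the right-hand side of the congruence.
-/

section Residues

open Finset Polynomial

variable {L : Type*} [Field L]

theorem eq_C_mul_nodal_of_natDegree_le_card {s : Finset L} {f : L[X]}
    (hf : f.natDegree ≤ s.card) (hfs : ∀ a ∈ s, f.eval a = 0) :
    f = C (f.coeff s.card) * Lagrange.nodal s id := by
  have hnat : (Lagrange.nodal s (id : L → L)).natDegree = s.card := Lagrange.natDegree_nodal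
  have hlead : (Lagrange.nodal s (id : L → L)).coeff s.card = 1 := by
    rw [← hnat]
    exact Lagrange.nodal_monic
  refine eq_of_degree_sub_lt_of_eval_finset_eq s ?_ fun a ha => ?_
  · rw [degree_lt_iff_coeff_zero]
    intro m hm
    rw [coeff_sub, coeff_C_mul]
    rcases hm.eq_or_lt with rfl | hm
    · rw [hlead, mul_one, sub_self]
    · rw [coeff_eq_zero_of_natDegree_lt (hf.trans_lt hm),
        coeff_eq_zero_of_natDegree_lt (hnat.trans_lt hm), mul_zero, sub_zero]
  · have hnode : (Lagrange.nodal s id).eval a = 0 := Lagrange.eval_nodal_at_node (v := id) ha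
    rw [hfs a ha, eval_mul, hnode, mul_zero]

theorem sum_eval_div_derivative {s : Finset L} {f g : L[X]} (hf : f.natDegree ≤ s.card)
    (hfs : ∀ a ∈ s, f.eval a = 0) (hg : g.degree < s.card) :
    ∑ a ∈ s, g.eval a / f.derivative.eval a = g.coeff (s.card - 1) / f.coeff s.card := by
  classical
  rw [Lagrange.coeff_eq_sum (v := id) Function.injective_id.injOn hg, sum_div]
  refine sum_congr rfl fun a ha => ?_
  have hnodal := Lagrange.eval_nodal_derivative_eval_node_eq (v := (id : L → L)) ha
  rw [Lagrange.eval_nodal] at hnodal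
  conv_lhs => rw [eq_C_mul_nodal_of_natDegree_le_card hf hfs]
  rw [derivative_C_mul, eval_C_mul, id, ← id_eq a, hnodal, div_div, mul_comm]
  rfl

/-- Residue theorem for `g / f * dw / w`: all finite nonzero poles are simple, and the right-hand
side is the contribution of `∞` and `0`. -/
theorem sum_eval_div_mul_derivative {s : Finset L} (hs : s.Nonempty) {f g : L[X]}
    (hf : f.natDegree ≤ s.card) (hg : g.natDegree ≤ s.card) (hfs : ∀ a ∈ s, f.eval a = 0)
    (hlead : f.coeff s.card ≠ 0) (hf0 : f.coeff 0 ≠ 0) :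
    ∑ a ∈ s, g.eval a / (a * f.derivative.eval a) =
      g.coeff s.card / f.coeff s.card - g.coeff 0 / f.coeff 0 := by
  set k := g.coeff 0 / f.coeff 0 with hk
  set h := divX (g - C k * f) with hh
  have hX : X * h = g - C k * f := by
    have hdiv := X_mul_divX_add (g - C k * f)
    rwa [coeff_sub, coeff_C_mul, hk, div_mul_cancel₀ _ hf0, sub_self, C_0, add_zero] at hdiv
  have hdeg : h.degree < s.card := by
    rw [degree_lt_iff_coeff_zero]
    intro m hm
    rw [hh, coeff_divX, coeff_sub, coeff_C_mul, coeff_eq_zero_of_natDegree_lt (by omega),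
      coeff_eq_zero_of_natDegree_lt (p := f) (by omega), mul_zero, sub_zero]
  have hterm : ∀ a ∈ s, g.eval a / (a * f.derivative.eval a) = h.eval a / f.derivative.eval a := by
    intro a ha
    have ha0 : a ≠ 0 := by
      rintro rfl
      exact hf0 (by rw [coeff_zero_eq_eval_zero, hfs 0 ha])
    have heval : a * h.eval a = g.eval a := by
      simpa only [eval_mul, eval_X, eval_sub, eval_C, hfs a ha, mul_zero, sub_zero]
        using congrArg (eval a) hX
    rw [← heval, mul_div_mul_left _ _ ha0]
  rw [sum_congr rfl hterm, sum_eval_div_derivative hf hfs hdeg, hh, coeff_divX,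
    Nat.sub_add_cancel hs.card_pos, coeff_sub, coeff_C_mul, sub_div, mul_div_cancel_right₀ _ hlead]

theorem coeff_prod_sum_of_natDegree_le {R J : Type*} [CommSemiring R] (s : Finset J)
    (f : J → R[X]) (n : J → ℕ) (h : ∀ j ∈ s, (f j).natDegree ≤ n j) :
    (∏ j ∈ s, f j).coeff (∑ j ∈ s, n j) = ∏ j ∈ s, (f j).coeff (n j) := by
  classical
  induction s using Finset.induction_on with
  | empty => simp
  | insert a s ha ih =>
    rw [forall_mem_insert] at h
    rw [prod_insert ha, sum_insert ha, prod_insert ha, coeff_mul_add_eq_of_natDegree_le h.1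
      ((natDegree_prod_le _ _).trans (sum_le_sum h.2)), ih h.2]

end Residues

section HyperbolicCotangent

open Finset Polynomial

variable {L : Type*} [Field L]

/-- The function `(u + 1) / (2 (u - 1))`, which is `coth (z / 2) / 2` in the variable
`u = exp z`. -/
def cothFun (u : L) : L := (u - 1)⁻¹ + 1 / 2

/-- The value of `cothFun (w ^ P * u)` at `w = ∞`. -/
def cothFunAtInfty (P : ℕ) (u : L) : L := if P = 0 then cothFun u else 1 / 2

/-- The value of `cothFun (w ^ P * u)` at `w = 0`. -/
def cothFunAtZero (P : ℕ) (u : L) : L := if P = 0 then cothFun u else -(1 / 2)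

/-- The numerator of `cothFun (w ^ P * u) = cothNum P u / cothDenom P u` as a polynomial in `w`. -/
noncomputable def cothNum (P : ℕ) (u : L) : L[X] := C (1 / 2) * (C u * X ^ P + 1)

/-- The denominator of `cothFun (w ^ P * u) = cothNum P u / cothDenom P u` as a polynomial
in `w`. -/
noncomputable def cothDenom (P : ℕ) (u : L) : L[X] := C u * X ^ P - 1

theorem natDegree_cothNum_le (P : ℕ) (u : L) : (cothNum P u).natDegree ≤ P :=
  (natDegree_C_mul_le _ _).trans
    ((natDegree_add_le _ _).trans (max_le (natDegree_C_mul_X_pow_le _ _) (by simp)))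

theorem natDegree_cothDenom_le (P : ℕ) (u : L) : (cothDenom P u).natDegree ≤ P :=
  (natDegree_sub_le _ _).trans (max_le (natDegree_C_mul_X_pow_le _ _) (by simp))

theorem eval_cothNum (P : ℕ) (u a : L) : (cothNum P u).eval a = 1 / 2 * (a ^ P * u + 1) := by
  simp [cothNum, mul_comm u]

theorem eval_cothDenom (P : ℕ) (u a : L) : (cothDenom P u).eval a = a ^ P * u - 1 := by
  simp [cothDenom, mul_comm u]

theorem mul_eval_derivative_cothDenom (P : ℕ) (u a : L) :
    a * (cothDenom P u).derivative.eval a = P * (a ^ P * u) := by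
  obtain _ | P := P
  · simp [cothDenom]
  · simp only [cothDenom, derivative_sub, derivative_C_mul_X_pow, derivative_one, sub_zero,
      eval_mul, eval_C, eval_pow, eval_X, Nat.add_sub_cancel]
    ring

theorem coeff_cothDenom_ne_zero {P : ℕ} {u : L} (hu : u ≠ 0) (hu1 : P = 0 → u ≠ 1) :
    (cothDenom P u).coeff P ≠ 0 := by
  rcases eq_or_ne P 0 with rfl | hP
  · simpa [cothDenom, sub_ne_zero] using hu1
  · simpa [cothDenom, coeff_one, hP] using hu

theorem coeff_zero_cothDenom_ne_zero {P : ℕ} {u : L} (hu1 : P = 0 → u ≠ 1) :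
    (cothDenom P u).coeff 0 ≠ 0 := by
  rcases eq_or_ne P 0 with rfl | hP
  · simpa [cothDenom, sub_ne_zero] using hu1
  · simp [cothDenom, coeff_X_pow, hP.symm]

variable [CharZero L]

theorem cothFun_eq_div {u : L} (hu : u ≠ 1) : cothFun u = 1 / 2 * (u + 1) / (u - 1) := by
  have hu' := sub_ne_zero.2 hu
  rw [cothFun]
  field_simp
  ring

theorem cothFun_inv {u : L} (h0 : u ≠ 0) (h1 : u ≠ 1) : cothFun u⁻¹ = -cothFun u := by
  have h2 := sub_ne_zero.2 h1
  have h3 : 1 - u ≠ 0 := sub_ne_zero.2 h1.symm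
  rw [cothFun_eq_div (inv_ne_one.2 h1), cothFun_eq_div h1]
  field_simp
  ring

theorem coeff_cothNum_div_coeff_cothDenom {P : ℕ} {u : L} (hu : u ≠ 0) (hu1 : P = 0 → u ≠ 1) :
    (cothNum P u).coeff P / (cothDenom P u).coeff P = cothFunAtInfty P u := by
  rcases eq_or_ne P 0 with rfl | hP
  · simp [cothNum, cothDenom, cothFunAtInfty, cothFun_eq_div (hu1 rfl)]
  · rw [cothNum, coeff_C_mul]
    simp [cothDenom, cothFunAtInfty, coeff_one, hP, hu]

theorem coeff_zero_cothNum_div_coeff_zero_cothDenom {P : ℕ} {u : L} (hu1 : P = 0 → u ≠ 1) :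
    (cothNum P u).coeff 0 / (cothDenom P u).coeff 0 = cothFunAtZero P u := by
  rcases eq_or_ne P 0 with rfl | hP
  · simp [cothNum, cothDenom, cothFunAtZero, cothFun_eq_div (hu1 rfl)]
  · simp [cothNum, cothDenom, cothFunAtZero, coeff_X_pow, hP, hP.symm, div_neg]

theorem eval_prod_cothNum_div_eval_derivative {J : Type*} [Fintype J] [DecidableEq J] (P : J → ℕ)
    (u : J → L) {a : L} {j : J} (haj : a ^ P j * u j = 1) (ha : ∀ i ≠ j, a ^ P i * u i ≠ 1) :
    (∏ i, cothNum (P i) (u i)).eval a /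
        (a * (∏ i, cothDenom (P i) (u i)).derivative.eval a) =
      (P j : L)⁻¹ * ∏ i ∈ univ.erase j, cothFun (a ^ P i * u i) := by
  have hderiv : a * (∏ i, cothDenom (P i) (u i)).derivative.eval a =
      P j * ∏ i ∈ univ.erase j, (a ^ P i * u i - 1) := by
    rw [← mul_prod_erase univ _ (mem_univ j), derivative_mul, eval_add, eval_mul, eval_mul,
      eval_cothDenom, haj, sub_self, zero_mul, add_zero, ← mul_assoc,
      mul_eval_derivative_cothDenom, haj, mul_one, eval_prod]
    simp only [eval_cothDenom]
  rw [hderiv, eval_prod, ← mul_prod_erase univ _ (mem_univ j), eval_cothNum, haj,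
    show (1 / 2 : L) * (1 + 1) = 1 by norm_num, one_mul, mul_comm (P j : L), ← div_div,
    ← prod_div_distrib, div_eq_inv_mul]
  congr 1
  refine prod_congr rfl fun i hi => ?_
  rw [eval_cothNum, cothFun_eq_div (ha i (ne_of_mem_erase hi))]

/-- The residue theorem for `∏ j, cothFun (w ^ P j * u j) * dw / w`, where `A j` lists the poles of
the `j`-th factor. -/
theorem sum_prod_cothFun_eq_sub {J : Type*} [Fintype J] [DecidableEq J] {P : J → ℕ} {u : J → L}
    {A : J → Finset L} (hu : ∀ j, u j ≠ 0) (hu1 : ∀ j, P j = 0 → u j ≠ 1)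
    (hA : ∀ j, ∀ a ∈ A j, a ^ P j * u j = 1) (hcard : ∀ j, (A j).card = P j)
    (hdisj : ∀ i j, i ≠ j → ∀ a ∈ A i, a ^ P j * u j ≠ 1) (hP : ∃ j, P j ≠ 0) :
    ∑ j, (P j : L)⁻¹ * ∑ a ∈ A j, ∏ i ∈ univ.erase j, cothFun (a ^ P i * u i) =
      ∏ j, cothFunAtInfty (P j) (u j) - ∏ j, cothFunAtZero (P j) (u j) := by
  classical
  have hpairwise : (Set.univ : Set J).PairwiseDisjoint A := fun i _ j _ hij =>
    disjoint_left.2 fun a hi hj => hdisj i j hij a hi (hA j a hj)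
  set s := univ.biUnion A with hs
  have hscard : s.card = ∑ j, P j := by
    rw [hs, card_biUnion fun i _ j _ => hpairwise (Set.mem_univ i) (Set.mem_univ j)]
    exact sum_congr rfl fun j _ => hcard j
  have hsne : s.Nonempty := by
    obtain ⟨j, hj⟩ := hP
    rw [← card_pos, hscard]
    exact (Nat.pos_of_ne_zero hj).trans_le (single_le_sum_of_canonicallyOrdered (mem_univ j))
  have hroot : ∀ a ∈ s, (∏ j, cothDenom (P j) (u j)).eval a = 0 := by
    intro a ha
    obtain ⟨j, -, hj⟩ := mem_biUnion.1 ha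
    rw [eval_prod]
    exact prod_eq_zero (mem_univ j) (by rw [eval_cothDenom, hA j a hj, sub_self])
  have hresidues := sum_eval_div_mul_derivative hsne (g := ∏ j, cothNum (P j) (u j))
    ((natDegree_prod_le _ _).trans (hscard ▸ sum_le_sum fun j _ => natDegree_cothDenom_le _ _))
    ((natDegree_prod_le _ _).trans (hscard ▸ sum_le_sum fun j _ => natDegree_cothNum_le _ _))
    hroot
    (by
      rw [hscard, coeff_prod_sum_of_natDegree_le _ _ _ fun j _ => natDegree_cothDenom_le _ _]
      exact prod_ne_zero_iff.2 fun j _ => coeff_cothDenom_ne_zero (hu j) (hu1 j))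
    (by
      rw [coeff_zero_prod]
      exact prod_ne_zero_iff.2 fun j _ => coeff_zero_cothDenom_ne_zero (hu1 j))
  rw [hscard, coeff_prod_sum_of_natDegree_le _ _ _ fun j _ => natDegree_cothDenom_le _ _,
    coeff_prod_sum_of_natDegree_le _ _ _ fun j _ => natDegree_cothNum_le _ _,
    coeff_zero_prod, coeff_zero_prod, ← prod_div_distrib, ← prod_div_distrib, hs,
    sum_biUnion fun i _ j _ => hpairwise (Set.mem_univ i) (Set.mem_univ j)] at hresidues
  simp only [coeff_cothNum_div_coeff_cothDenom (hu _) (hu1 _),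
    coeff_zero_cothNum_div_coeff_zero_cothDenom (hu1 _)] at hresidues
  rw [← hresidues]
  refine sum_congr rfl fun j _ => ?_
  rw [mul_sum]
  exact sum_congr rfl fun a ha => (eval_prod_cothNum_div_eval_derivative P u (hA j a ha)
    fun i hi => hdisj j i hi.symm a ha).symm

end HyperbolicCotangent

section BernoulliFourier

open PowerSeries

/-- The normalization `Q ^ (r - 1) * periodicBernoulli r (k / Q) / r!` for which the finite Fourier
transform has the generating function `bernoulliFourier_generating_function`. -/
noncomputable def bernoulliWeight (Q r k : ℕ) : ℚ :=
  (Q : ℚ) ^ ((r : ℤ) - 1) * (periodicBernoulli r ((k : ℚ) / Q) / r.factorial)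

/-- The finite Fourier transform of `bernoulliWeight Q r`, at a root of unity `w` of order dividing
`Q`. -/
noncomputable def bernoulliFourier {K : Type*} [Field K] (Q r : ℕ) (w : K) : K :=
  ∑ k ∈ Finset.range Q, w ^ k * (bernoulliWeight Q r k : K)

theorem periodicBernoulli_eq_of_mem_Ico {t : ℚ} (ht : t ∈ Set.Ico (0 : ℚ) 1) (r : ℕ) :
    periodicBernoulli r t =
      (Polynomial.bernoulli r).eval t + if r = 1 ∧ t = 0 then 1 / 2 else 0 := by
  rw [periodicBernoulli, Int.fract_eq_self.2 ht]
  split_ifs with h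
  · rw [h.1, h.2, Polynomial.bernoulli_one]
    norm_num
  · rw [add_zero]

variable {K : Type*} [Field K] [CharZero K]

variable (K) in
theorem periodicBernoulli_generating_function {t : ℚ} (ht : t ∈ Set.Ico (0 : ℚ) 1) :
    (mk fun r => ((periodicBernoulli r t / r.factorial : ℚ) : K)) * (exp K - 1) =
      X * rescale (t : K) (exp K) + if t = 0 then C (1 / 2) * X * (exp K - 1) else 0 := by
  have hseries : (mk fun r => ((periodicBernoulli r t / r.factorial : ℚ) : K)) =
      (mk fun r => Polynomial.aeval (t : K)
        ((1 / (r.factorial : ℚ)) • Polynomial.bernoulli r)) +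
        if t = 0 then C (1 / 2) * X else 0 := by
    ext r
    have haeval : Polynomial.aeval (t : K) ((1 / (r.factorial : ℚ)) • Polynomial.bernoulli r) =
        (((Polynomial.bernoulli r).eval t / r.factorial : ℚ) : K) := by
      rw [← eq_ratCast (algebraMap ℚ K) t, Polynomial.aeval_algebraMap_apply, eq_ratCast,
        Polynomial.coe_aeval_eq_eval, Polynomial.eval_smul, smul_eq_mul, one_div_mul_eq_div]
    rw [coeff_mk, map_add, coeff_mk, haeval, periodicBernoulli_eq_of_mem_Ico ht]
    rcases eq_or_ne t 0 with rfl | h0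
    · rcases eq_or_ne r 1 with rfl | h1
      · simp [coeff_succ_mul_X]
      · rw [if_pos rfl, coeff_C_mul, coeff_X, if_neg h1]
        simp [h1]
    · simp [h0]
  rw [hseries, add_mul, Polynomial.bernoulli_generating_function]
  split_ifs <;> simp

omit [CharZero K] in
theorem rescale_C (a b : K) : rescale a (C b) = C b := by
  ext r
  rw [coeff_rescale, coeff_C]
  split_ifs with h <;> simp [h]

theorem rescale_exp_sub_one_ne_zero {a : K} (ha : a ≠ 0) : rescale a (exp K) - 1 ≠ 0 := by
  intro h
  have hcoeff := congrArg (coeff 1) h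
  simp [coeff_rescale, coeff_one, ha] at hcoeff

theorem C_mul_mk_bernoulliFourier {Q : ℕ} (hQ : Q ≠ 0) (w : K) :
    C (Q : K) * mk (bernoulliFourier Q · w) =
      ∑ k ∈ Finset.range Q, C (w ^ k) * rescale (Q : K)
        (mk fun r => ((periodicBernoulli r ((k : ℚ) / Q) / r.factorial : ℚ) : K)) := by
  have hQK : (Q : K) ≠ 0 := by exact_mod_cast hQ
  ext r
  simp only [coeff_C_mul, coeff_mk, map_sum, bernoulliFourier, Finset.mul_sum, coeff_rescale]
  refine Finset.sum_congr rfl fun k _ => ?_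
  rw [bernoulliWeight, zpow_sub_one₀ (by exact_mod_cast hQ), zpow_natCast]
  push_cast
  field_simp

theorem C_mul_mk_bernoulliFourier_mul {Q : ℕ} (hQ : Q ≠ 0) (w : K) :
    C (Q : K) * mk (bernoulliFourier Q · w) * (rescale (Q : K) (exp K) - 1) =
      C (Q : K) * (X * ∑ k ∈ Finset.range Q, (C w * exp K) ^ k +
        C (1 / 2) * X * (rescale (Q : K) (exp K) - 1)) := by
  have hQK : (Q : K) ≠ 0 := by exact_mod_cast hQ
  have hterm : ∀ k ∈ Finset.range Q, C (w ^ k) * rescale (Q : K)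
      (mk fun r => ((periodicBernoulli r ((k : ℚ) / Q) / r.factorial : ℚ) : K)) *
        (rescale (Q : K) (exp K) - 1) =
      C (Q : K) * (X * (C w * exp K) ^ k +
        if k = 0 then C (1 / 2) * X * (rescale (Q : K) (exp K) - 1) else 0) := by
    intro k hk
    have ht : (k : ℚ) / Q ∈ Set.Ico (0 : ℚ) 1 :=
      ⟨by positivity, (div_lt_one (by positivity)).2 (by exact_mod_cast Finset.mem_range.1 hk)⟩
    have hgen := congrArg (rescale (Q : K)) (periodicBernoulli_generating_function K ht)
    rw [map_mul, map_sub, map_one, map_add, map_mul, rescale_X, rescale_rescale,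
      Rat.cast_div, Rat.cast_natCast, Rat.cast_natCast, div_mul_cancel₀ _ hQK,
      ← exp_pow_eq_rescale_exp k] at hgen
    rw [mul_assoc, hgen, mul_pow, map_pow]
    rcases eq_or_ne k 0 with rfl | hk0
    · simp only [Nat.cast_zero, zero_div, if_true, map_mul, map_sub, map_one, rescale_X, rescale_C]
      ring
    · have hk0' : ((k : ℚ) / Q) ≠ 0 := by positivity
      rw [if_neg hk0', if_neg hk0, map_zero]
      ring
  rw [C_mul_mk_bernoulliFourier hQ, Finset.sum_mul, Finset.sum_congr rfl hterm, ← Finset.mul_sum,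
    Finset.sum_add_distrib, Finset.sum_ite_eq' (Finset.range Q) 0,
    if_pos (Finset.mem_range.2 (Nat.pos_of_ne_zero hQ)), Finset.mul_sum]

theorem bernoulliFourier_generating_function {Q : ℕ} (hQ : Q ≠ 0) {w : K} (hw : w ^ Q = 1) :
    mk (bernoulliFourier Q · w) * (C w * exp K - 1) =
      C (1 / 2) * X * (C w * exp K + 1) := by
  have hQK : (Q : K) ≠ 0 := by exact_mod_cast hQ
  have hgeom := geom_sum_mul (C w * exp K) Q
  rw [mul_pow, ← map_pow, hw, map_one, one_mul, exp_pow_eq_rescale_exp] at hgeom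
  have hfourier := C_mul_mk_bernoulliFourier_mul hQ w
  have hhalf : (C (1 / 2) : K⟦X⟧) + C (1 / 2) = 1 := by rw [← map_add, add_halves, map_one]
  refine mul_left_cancel₀ (rescale_exp_sub_one_ne_zero hQK)
    (mul_left_cancel₀ ((map_ne_zero_iff _ C_injective).2 hQK) ?_)
  linear_combination (C w * exp K - 1) * hfourier + C (Q : K) * X * hgeom -
    C (Q : K) * X * (rescale (Q : K) (exp K) - 1) * hhalf

end BernoulliFourier

section ExpLaurent

open PowerSeries

variable {K : Type*} [Field K]

instance instCharZeroLaurentSeries [CharZero K] : CharZero (LaurentSeries K) :=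
  charZero_of_injective_algebraMap (algebraMap K _).injective

variable [CharZero K]

/-- The exponential `exp (x z)` as a Laurent series in `z`. -/
noncomputable def expLaurent (x : K) : LaurentSeries K :=
  HahnSeries.ofPowerSeries ℤ K (rescale x (exp K))

theorem expLaurent_add (x y : K) : expLaurent (x + y) = expLaurent x * expLaurent y := by
  rw [expLaurent, expLaurent, expLaurent, ← map_mul, exp_mul_exp_eq_exp_add]

@[simp] theorem expLaurent_zero : expLaurent (0 : K) = 1 := by
  simp [expLaurent, rescale_zero]

theorem expLaurent_nat_mul (n : ℕ) (x : K) : expLaurent (n * x) = expLaurent x ^ n := by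
  induction n with
  | zero => simp
  | succ n ih => rw [pow_succ, ← ih, ← expLaurent_add, Nat.cast_add_one, add_one_mul]

theorem expLaurent_neg (x : K) : expLaurent (-x) = (expLaurent x)⁻¹ :=
  eq_inv_of_mul_eq_one_left (by rw [← expLaurent_add, neg_add_cancel, expLaurent_zero])

theorem expLaurent_ne_zero (x : K) : expLaurent x ≠ 0 :=
  left_ne_zero_of_mul_eq_one (b := expLaurent (-x))
    (by rw [← expLaurent_add, add_neg_cancel, expLaurent_zero])

theorem C_mul_expLaurent_ne_one {w x : K} (hw : w ≠ 0) (hx : x ≠ 0) :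
    HahnSeries.C w * expLaurent x ≠ 1 := by
  intro h
  rw [expLaurent, ← HahnSeries.ofPowerSeries_C (Γ := ℤ), ← map_mul,
    ← map_one (HahnSeries.ofPowerSeries ℤ K)] at h
  have hcoeff := congrArg (coeff 1) (HahnSeries.ofPowerSeries_injective h)
  simp [coeff_rescale, coeff_one, hw, hx] at hcoeff

/-- The expansion of `z * cothFun (w * exp (x z))` at `z = 0`, for a root of unity `w`. -/
theorem single_mul_cothFun {Q : ℕ} (hQ : Q ≠ 0) {w x : K} (hw : w ^ Q = 1) (hx : x ≠ 0) :
    HahnSeries.single (1 : ℤ) (1 : K) * cothFun (HahnSeries.C w * expLaurent x) =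
      HahnSeries.ofPowerSeries ℤ K (mk fun r => bernoulliFourier Q r w * x ^ ((r : ℤ) - 1)) := by
  have hw0 : w ≠ 0 := by
    rintro rfl
    exact zero_ne_one ((zero_pow hQ).symm.trans hw)
  have hrescale : rescale x (mk (bernoulliFourier Q · w)) =
      C x * mk fun r => bernoulliFourier Q r w * x ^ ((r : ℤ) - 1) := by
    ext r
    rw [coeff_rescale, coeff_mk, coeff_C_mul, coeff_mk, zpow_sub_one₀ hx, zpow_natCast]
    field_simp
  have hgen := congrArg (rescale x) (bernoulliFourier_generating_function hQ hw)
  simp only [map_mul, map_sub, map_add, map_one, hrescale, rescale_C, rescale_X] at hgen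
  set F := mk fun r => bernoulliFourier Q r w * x ^ ((r : ℤ) - 1)
  have hF : F * (C w * rescale x (exp K) - 1) = C (1 / 2) * X * (C w * rescale x (exp K) + 1) :=
    mul_left_cancel₀ ((map_ne_zero_iff _ C_injective).2 hx) (by linear_combination hgen)
  have hlaurent : HahnSeries.ofPowerSeries ℤ K F * (HahnSeries.C w * expLaurent x - 1) =
      HahnSeries.C (1 / 2) * HahnSeries.single 1 1 * (HahnSeries.C w * expLaurent x + 1) := by
    simpa only [expLaurent, map_mul, map_sub, map_add, map_one, HahnSeries.ofPowerSeries_C,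
      HahnSeries.ofPowerSeries_X] using congrArg (HahnSeries.ofPowerSeries ℤ K) hF
  have hne := C_mul_expLaurent_ne_one hw0 hx
  have hhalf : (HahnSeries.C (1 / 2 : K) : LaurentSeries K) = 1 / 2 := by
    rw [map_div₀, map_one, map_ofNat]
  rw [cothFun_eq_div hne, mul_div_assoc', eq_comm, eq_div_iff (sub_ne_zero.2 hne), hlaurent, hhalf]
  ring

end ExpLaurent

section CothSum

open Finset Polynomial

variable {K : Type*} [Field K] {ι : Type*} [Fintype ι]

theorem sum_piAntidiag_univ_eq_sum_finsuppAntidiag {M : Type*} [AddCommMonoid M] [DecidableEq ι]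
    (f : (ι → ℕ) → M) (N : ℕ) :
    ∑ m ∈ piAntidiag univ N, f m = ∑ m ∈ finsuppAntidiag (univ : Finset ι) N, f m :=
  sum_nbij' Finsupp.equivFunOnFinite.symm (⇑) (by simp) (by simp) (fun _ _ => rfl)
    (fun _ _ => Finsupp.ext fun _ => rfl) (fun _ _ => rfl)

theorem coeff_prod_of_single_mul [DecidableEq ι] {g : ι → LaurentSeries K} {F : ι → PowerSeries K}
    (h : ∀ i, HahnSeries.single (1 : ℤ) (1 : K) * g i = HahnSeries.ofPowerSeries ℤ K (F i))
    (N : ℕ) :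
    (∏ i, g i).coeff ((N : ℤ) - Fintype.card ι) =
      ∑ m ∈ piAntidiag univ N, ∏ i, PowerSeries.coeff (m i) (F i) := by
  have hprod : HahnSeries.single (Fintype.card ι : ℤ) (1 : K) * ∏ i, g i =
      HahnSeries.ofPowerSeries ℤ K (∏ i, F i) := by
    rw [map_prod, ← prod_congr rfl fun i _ => h i, prod_mul_distrib, prod_const,
      HahnSeries.single_pow, card_univ, nsmul_eq_mul, mul_one, one_pow]
  have hcoeff := congrArg (HahnSeries.coeff · (N : ℤ)) hprod
  simp only [HahnSeries.coeff_single_mul, one_mul, HahnSeries.ofPowerSeries_apply_coeff] at hcoeff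
  rw [hcoeff, PowerSeries.coeff_prod, sum_piAntidiag_univ_eq_sum_finsuppAntidiag]

/-- The generalized Dedekind sum of modulus `Q` and weights `P`, in the symmetric form of a sum over
the residues with `∑ i, P i * k i ≡ 0`, and normalized to be a coefficient of `cothSum`. -/
noncomputable def dedekindCoeff [DecidableEq ι] (Q : ℕ) (P : ι → ℕ) (r : ι → ℕ) : ℚ :=
  Q * ∑ k : ι → Fin Q, if Q ∣ ∑ i, P i * (k i : ℕ) then ∏ i, bernoulliWeight Q (r i) (k i) else 0

variable [CharZero K]

/-- The sum of `∏ i, cothFun (w ^ P i * exp (X i * z))` over the `Q`-th roots of unity `w`. -/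
noncomputable def cothSum (Q : ℕ) (P : ι → ℕ) (X : ι → K) : LaurentSeries K :=
  ∑ w ∈ nthRootsFinset Q (1 : K), ∏ i, cothFun (HahnSeries.C (w ^ P i) * expLaurent (X i))

/-- The mean of the contributions of `w = ∞` and `w = 0` to the residue theorem for
`∏ i, cothFun (w ^ P i * exp (X i * z)) * dw / w`. -/
noncomputable def cothBoundary (P : ι → ℕ) (X : ι → K) : LaurentSeries K :=
  1 / 2 * (∏ i, cothFunAtInfty (P i) (expLaurent (X i)) +
    ∏ i, cothFunAtZero (P i) (expLaurent (X i)))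

theorem C_mul_expLaurent_pow_mul (w x y : K) (m : ℕ) :
    (HahnSeries.C w * expLaurent y) ^ m * expLaurent x =
      HahnSeries.C (w ^ m) * expLaurent (x + m * y) := by
  rw [mul_pow, ← expLaurent_nat_mul, mul_assoc, ← expLaurent_add, map_pow, add_comm]

section AlgClosed

variable [IsAlgClosed K]

variable (K) in
theorem exists_isPrimitiveRoot {Q : ℕ} (hQ : Q ≠ 0) : ∃ ζ : K, IsPrimitiveRoot ζ Q := by
  have : NeZero (Q : K) := ⟨by exact_mod_cast hQ⟩
  exact HasEnoughRootsOfUnity.exists_primitiveRoot K Q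

theorem card_nthRootsFinset_one (Q : ℕ) : (nthRootsFinset Q (1 : K)).card = Q := by
  rcases eq_or_ne Q 0 with rfl | hQ
  · simp
  · obtain ⟨ζ, hζ⟩ := exists_isPrimitiveRoot K hQ
    exact hζ.card_nthRootsFinset

theorem sum_pow_nthRootsFinset {Q : ℕ} (hQ : Q ≠ 0) (m : ℕ) :
    ∑ w ∈ nthRootsFinset Q (1 : K), w ^ m = if Q ∣ m then (Q : K) else 0 := by
  have hmem (w : K) : w ∈ nthRootsFinset Q (1 : K) ↔ w ^ Q = 1 :=
    mem_nthRootsFinset (Nat.pos_of_ne_zero hQ) 1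
  split_ifs with hm
  · obtain ⟨c, rfl⟩ := hm
    rw [sum_congr rfl fun w hw => by rw [pow_mul, (hmem w).1 hw, one_pow], sum_const,
      card_nthRootsFinset_one, nsmul_eq_mul, mul_one]
  · obtain ⟨ζ, hζ⟩ := exists_isPrimitiveRoot K hQ
    have hne : ζ ^ m ≠ 1 := fun h => hm ((hζ.pow_eq_one_iff_dvd m).1 h)
    have hinvariant : ∑ w ∈ nthRootsFinset Q (1 : K), w ^ m =
        ζ ^ m * ∑ w ∈ nthRootsFinset Q (1 : K), w ^ m := by
      rw [mul_sum]
      refine (sum_equiv (Equiv.mulLeft₀ ζ (hζ.ne_zero hQ)) (fun w => ?_) fun w _ => ?_).symm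
      · rw [Equiv.mulLeft₀_apply, hmem, hmem, mul_pow, hζ.pow_eq_one, one_mul]
      · rw [Equiv.mulLeft₀_apply, mul_pow]
    exact (mul_left_eq_self₀.1 hinvariant.symm).resolve_left hne

theorem sum_prod_bernoulliFourier [DecidableEq ι] {Q : ℕ} (hQ : Q ≠ 0) (P r : ι → ℕ) :
    ∑ w ∈ nthRootsFinset Q (1 : K), ∏ i, bernoulliFourier Q (r i) (w ^ P i) =
      (dedekindCoeff Q P r : K) := by
  have hexpand (w : K) : ∏ i, bernoulliFourier Q (r i) (w ^ P i) =
      ∑ k : ι → Fin Q, w ^ (∑ i, P i * (k i : ℕ)) *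
        ((∏ i, bernoulliWeight Q (r i) (k i) : ℚ) : K) := by
    simp only [bernoulliFourier, sum_range]
    rw [prod_univ_sum, Fintype.piFinset_univ]
    refine sum_congr rfl fun k _ => ?_
    rw [prod_mul_distrib, ← prod_pow_eq_pow_sum, Rat.cast_prod]
    simp only [pow_mul]
  rw [sum_congr rfl fun w _ => hexpand w, sum_comm, dedekindCoeff]
  push_cast
  rw [mul_sum]
  refine sum_congr rfl fun k _ => ?_
  rw [← sum_mul, sum_pow_nthRootsFinset hQ]
  split_ifs <;> simp

theorem coeff_cothSum [DecidableEq ι] {Q : ℕ} (hQ : Q ≠ 0) (P : ι → ℕ) {X : ι → K}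
    (hX : ∀ i, X i ≠ 0) (N : ℕ) :
    (cothSum Q P X).coeff ((N : ℤ) - Fintype.card ι) =
      ∑ r ∈ piAntidiag univ N, (dedekindCoeff Q P r : K) * ∏ i, X i ^ ((r i : ℤ) - 1) := by
  have hexpand : ∀ w ∈ nthRootsFinset Q (1 : K),
      (∏ i, cothFun (HahnSeries.C (w ^ P i) * expLaurent (X i))).coeff
        ((N : ℤ) - Fintype.card ι) =
      ∑ r ∈ piAntidiag univ N, ∏ i, bernoulliFourier Q (r i) (w ^ P i) *
        X i ^ ((r i : ℤ) - 1) := by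
    intro w hw
    have hpow (i : ι) : (w ^ P i) ^ Q = 1 := by
      rw [← pow_mul, mul_comm, pow_mul, (mem_nthRootsFinset (Nat.pos_of_ne_zero hQ) 1).1 hw,
        one_pow]
    simpa only [PowerSeries.coeff_mk] using
      coeff_prod_of_single_mul (fun i => single_mul_cothFun hQ (hpow i) (hX i)) N
  rw [cothSum, HahnSeries.coeff_sum, sum_congr rfl hexpand, sum_comm]
  refine sum_congr rfl fun r _ => ?_
  simp only [prod_mul_distrib]
  rw [← sum_mul, sum_prod_bernoulliFourier hQ]

/-- The residue theorem for `∏ j, cothFun (w ^ P j * exp (X j * z)) * dw / w`: the poles of the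
`j`-th factor are the `w * exp (-(X j / P j) * z)` for the `P j`-th roots of unity `w`. -/
theorem sum_cothFun_expLaurent_eq_sub {J : Type*} [Fintype J] [DecidableEq J] {P : J → ℕ}
    {X : J → K} (hP : ∃ j, P j ≠ 0) (hX : ∀ j, P j = 0 → X j ≠ 0)
    (hXX : ∀ i j, i ≠ j → P i ≠ 0 → X j - P j * X i / P i ≠ 0) :
    ∑ j, (P j : LaurentSeries K)⁻¹ * ∑ w ∈ nthRootsFinset (P j) (1 : K),
        ∏ i ∈ univ.erase j,
          cothFun (HahnSeries.C (w ^ P i) * expLaurent (X i - P i * X j / P j)) =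
      ∏ j, cothFunAtInfty (P j) (expLaurent (X j)) -
        ∏ j, cothFunAtZero (P j) (expLaurent (X j)) := by
  classical
  let pole (j : J) (w : K) : LaurentSeries K := HahnSeries.C w * expLaurent (-(X j / P j))
  have hpole_injective (j : J) : Function.Injective (pole j) := fun a b h =>
    HahnSeries.C_injective (mul_right_cancel₀ (expLaurent_ne_zero _) h)
  have hpole (i j : J) (w : K) : pole j w ^ P i * expLaurent (X i) =
      HahnSeries.C (w ^ P i) * expLaurent (X i - P i * X j / P j) := by
    rw [C_mul_expLaurent_pow_mul, mul_neg, ← sub_eq_add_neg, mul_div_assoc]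
  have hroot : ∀ j, ∀ w ∈ nthRootsFinset (P j) (1 : K), P j ≠ 0 ∧ w ^ P j = 1 := by
    intro j w hw
    have hPj : P j ≠ 0 := by
      rintro h
      simp [h] at hw
    exact ⟨hPj, (mem_nthRootsFinset (Nat.pos_of_ne_zero hPj) 1).1 hw⟩
  have hresidues := sum_prod_cothFun_eq_sub (P := P) (u := fun j => expLaurent (X j))
    (A := fun j => (nthRootsFinset (P j) (1 : K)).image (pole j))
    (fun j => expLaurent_ne_zero _)
    (fun j hj => by simpa using C_mul_expLaurent_ne_one (one_ne_zero (α := K)) (hX j hj))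
    (fun j => forall_mem_image.2 fun w hw => by
      obtain ⟨hPj, hw⟩ := hroot j w hw
      rw [hpole, hw, mul_div_cancel_left₀ _ (Nat.cast_ne_zero.2 hPj), sub_self, expLaurent_zero,
        map_one, one_mul])
    (fun j => by
      rw [card_image_of_injective _ (hpole_injective j), card_nthRootsFinset_one])
    (fun i j hij => forall_mem_image.2 fun w hw => by
      rw [hpole]
      exact C_mul_expLaurent_ne_one
        (pow_ne_zero _ (ne_zero_of_mem_nthRootsFinset one_ne_zero hw))
        (hXX i j hij (hroot i w hw).1))
    hP
  rw [← hresidues]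
  refine sum_congr rfl fun j _ => ?_
  rw [sum_image fun _ _ _ _ h => hpole_injective j h]
  simp only [hpole]

theorem prod_univ_erase_some {M : Type*} [CommMonoid M] [DecidableEq ι] (f : Option ι → M)
    (i : ι) :
    ∏ j ∈ univ.erase (some i), f j = ∏ j, Function.update (fun j => f (some j)) i (f none) j := by
  have herase : univ.erase (some i) = insertNone (univ \ {i}) := by
    ext (_ | j) <;> simp
  rw [herase, prod_insertNone, prod_update_of_mem (mem_univ i)]

/-- The linear forms `X j - P j * X i / P i`, with `-Q * X i / P i` at the place `i`, that the
exponents become at the poles of the `i`-th factor of `cothSum Q P X`. -/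
noncomputable def reciprocalForms [DecidableEq ι] (Q : ℕ) (P : ι → ℕ) (X : ι → K) (i : ι) :
    ι → K :=
  Function.update (fun j => X j - P j * X i / P i) i (-(Q * X i / P i))

theorem cothSum_reciprocity [DecidableEq ι] {Q : ℕ} (hQ : Q ≠ 0) {P : ι → ℕ} {X : ι → K}
    (hX : ∀ i, X i ≠ 0) (hXX : ∀ i j, i ≠ j → P i ≠ 0 → X j - P j * X i / P i ≠ 0) :
    (Q : LaurentSeries K)⁻¹ * cothSum Q P X +
        ∑ i, (P i : LaurentSeries K)⁻¹ *
          cothSum (P i) (Function.update P i Q) (reciprocalForms Q P X i) =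
      cothBoundary P X := by
  have hresidues := sum_cothFun_expLaurent_eq_sub (K := K) (P := fun o : Option ι => o.elim Q P)
    (X := fun o : Option ι => o.elim 0 X) ⟨none, hQ⟩
    (by
      rintro (_ | i) h
      exacts [absurd h hQ, hX i])
    (by
      rintro (_ | i) (_ | j) hij hPi
      · exact absurd rfl hij
      · simpa using hX j
      · simpa [hQ, hX i] using hPi
      · exact hXX i j (fun h => hij (congrArg some h)) hPi)
  rw [Fintype.sum_option, Fintype.prod_option, Fintype.prod_option] at hresidues
  have hinfty (u : LaurentSeries K) : cothFunAtInfty Q u = 1 / 2 := if_neg hQ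
  have hzero (u : LaurentSeries K) : cothFunAtZero Q u = -(1 / 2) := if_neg hQ
  have hnone : univ.erase none = univ.map (Function.Embedding.some (α := ι)) := by
    ext (_ | i) <;> simp
  have hfactor (i j : ι) (w : K) : Function.update
      (fun j => cothFun (HahnSeries.C (w ^ P j) * expLaurent (X j - P j * X i / P i))) i
      (cothFun (HahnSeries.C (w ^ Q) * expLaurent (0 - Q * X i / P i))) j =
      cothFun (HahnSeries.C (w ^ Function.update P i Q j) *
        expLaurent (reciprocalForms Q P X i j)) := by
    rcases eq_or_ne j i with rfl | hj
    · simp only [Function.update_self, reciprocalForms, zero_sub]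
    · simp only [Function.update_of_ne hj, reciprocalForms]
  simp only [hnone, prod_map, Function.Embedding.some_apply, prod_univ_erase_some, Option.elim,
    hfactor, mul_zero, zero_div, sub_zero, hinfty, hzero] at hresidues
  simp only [cothSum, cothBoundary]
  rw [hresidues]
  ring

end AlgClosed

end CothSum

section CothCoeff

open Finset

/-- The coefficient of `z ^ m` in `z * cothFun (exp z)`. -/
noncomputable def cothCoeff (m : ℕ) : ℚ := periodicBernoulli m 0 / m.factorial

variable {K : Type*} [Field K] [CharZero K]

theorem bernoulliFourier_one_one (m : ℕ) : bernoulliFourier 1 m (1 : K) = cothCoeff m := by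
  simp [bernoulliFourier, bernoulliWeight, cothCoeff]

theorem single_mul_cothFun_expLaurent {x : K} (hx : x ≠ 0) :
    HahnSeries.single (1 : ℤ) (1 : K) * cothFun (expLaurent x) =
      HahnSeries.ofPowerSeries ℤ K
        (PowerSeries.mk fun m => (cothCoeff m : K) * x ^ ((m : ℤ) - 1)) := by
  simpa [bernoulliFourier_one_one] using
    single_mul_cothFun one_ne_zero (one_pow 1 : (1 : K) ^ 1 = 1) hx

end CothCoeff

section Unimodular

open Finset

variable {K : Type*} [Field K] {ι : Type*} [Fintype ι] {O : Subring K} {ℓ : ℕ}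

/-- `y` is a unit of the subring `O` of the field `K`. -/
def IsUnitIn (O : Subring K) (y : K) : Prop := y ≠ 0 ∧ y ∈ O ∧ y⁻¹ ∈ O

theorem IsUnitIn.zpow_mem {y : K} (hy : IsUnitIn O y) (e : ℤ) : y ^ e ∈ O := by
  obtain ⟨n, rfl | rfl⟩ := e.eq_nat_or_neg
  · rw [zpow_natCast]
    exact pow_mem hy.2.1 n
  · rw [zpow_neg, zpow_natCast, ← inv_pow]
    exact pow_mem hy.2.2 n

/-- Every integral combination of the family `X` that is primitive at `ℓ` is a unit of `O`. This
notion is stable under the changes of variables in `cothSum_reciprocity`. -/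
def Unimodular (O : Subring K) (ℓ : ℕ) (X : ι → K) : Prop :=
  ∀ c : ι → ℤ, (∃ i, ¬ (ℓ : ℤ) ∣ c i) → IsUnitIn O (∑ i, (c i : K) * X i)

variable {X : ι → K}

theorem Unimodular.isUnitIn (hX : Unimodular O ℓ X) (hℓ : ℓ.Prime) (i : ι) :
    IsUnitIn O (X i) := by
  classical
  have hprimitive : ¬ (ℓ : ℤ) ∣ Pi.single (M := fun _ => ℤ) i 1 i := by
    rw [Pi.single_eq_same]
    exact (Nat.prime_iff_prime_int.1 hℓ).not_dvd_one
  simpa [Pi.single_apply] using hX (Pi.single i 1) ⟨i, hprimitive⟩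

theorem Unimodular.units_mul (hX : Unimodular O ℓ X) (ε : ι → ℤˣ) :
    Unimodular O ℓ fun i => ((ε i : ℤ) : K) * X i := by
  intro c ⟨i, hi⟩
  have hunit := hX (fun i => c i * ε i) ⟨i, by rwa [(ε i).isUnit.dvd_mul_right]⟩
  simpa only [Int.cast_mul, mul_assoc] using hunit

/-- The coefficients of `P i • ∑ j, c j • reciprocalForms Q P X i j` in terms of `X`. -/
def reciprocalCoeffs [DecidableEq ι] (Q : ℕ) (P : ι → ℕ) (c : ι → ℤ) (i : ι) : ι → ℤ :=
  Function.update (fun j => P i * c j) i (-(Q * c i + ∑ j ∈ univ.erase i, c j * P j))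

theorem sum_mul_reciprocalForms [DecidableEq ι] (Q : ℕ) {P : ι → ℕ} (c : ι → ℤ) (X : ι → K)
    {i : ι} (hi : (P i : K) ≠ 0) :
    ∑ j, (c j : K) * reciprocalForms Q P X i j =
      (P i : K)⁻¹ * ∑ j, (reciprocalCoeffs Q P c i j : K) * X j := by
  have hforms : ∀ j ∈ univ.erase i, (c j : K) * reciprocalForms Q P X i j =
      c j * X j - (c j * P j) * (X i / P i) := by
    intro j hj
    rw [reciprocalForms, Function.update_of_ne (ne_of_mem_erase hj)]
    ring
  have hcoeffs : ∀ j ∈ univ.erase i, (reciprocalCoeffs Q P c i j : K) * X j =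
      P i * (c j * X j) := by
    intro j hj
    rw [reciprocalCoeffs, Function.update_of_ne (ne_of_mem_erase hj)]
    push_cast
    ring
  rw [← add_sum_erase _ _ (mem_univ i),
    ← add_sum_erase _ (fun j => (reciprocalCoeffs Q P c i j : K) * X j) (mem_univ i),
    sum_congr rfl hforms, sum_congr rfl hcoeffs, sum_sub_distrib, ← sum_mul, ← mul_sum,
    reciprocalCoeffs, Function.update_self, reciprocalForms, Function.update_self]
  push_cast
  field_simp
  ring

theorem exists_not_dvd_reciprocalCoeffs [DecidableEq ι] (hℓ : ℓ.Prime) {Q : ℕ} (hQ : ¬ ℓ ∣ Q)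
    {P : ι → ℕ} {i : ι} (hi : ¬ ℓ ∣ P i) {c : ι → ℤ} (hc : ∃ j, ¬ (ℓ : ℤ) ∣ c j) :
    ∃ j, ¬ (ℓ : ℤ) ∣ reciprocalCoeffs Q P c i j := by
  have hprime : Prime (ℓ : ℤ) := Nat.prime_iff_prime_int.1 hℓ
  by_cases hcj : ∃ j ≠ i, ¬ (ℓ : ℤ) ∣ c j
  · obtain ⟨j, hj, hcj⟩ := hcj
    refine ⟨j, ?_⟩
    rw [reciprocalCoeffs, Function.update_of_ne hj, hprime.dvd_mul, Int.natCast_dvd_natCast]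
    exact not_or.2 ⟨hi, hcj⟩
  · push Not at hcj
    have hci : ¬ (ℓ : ℤ) ∣ c i := by
      obtain ⟨j, hj⟩ := hc
      rcases eq_or_ne j i with rfl | hji
      exacts [hj, absurd (hcj j hji) hj]
    have hsum : (ℓ : ℤ) ∣ ∑ j ∈ univ.erase i, c j * P j :=
      dvd_sum fun j hj => (hcj j (ne_of_mem_erase hj)).mul_right _
    refine ⟨i, ?_⟩
    rw [reciprocalCoeffs, Function.update_self, dvd_neg, dvd_add_left hsum, hprime.dvd_mul,
      Int.natCast_dvd_natCast]
    exact not_or.2 ⟨hQ, hci⟩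

theorem Unimodular.unimodular_reciprocalForms [DecidableEq ι] (hX : Unimodular O ℓ X)
    (hℓ : ℓ.Prime) (hO : ∀ m : ℕ, ¬ ℓ ∣ m → IsUnitIn O (m : K)) {Q : ℕ} (hQ : ¬ ℓ ∣ Q)
    {P : ι → ℕ} {i : ι} (hi : ¬ ℓ ∣ P i) :
    Unimodular O ℓ (reciprocalForms Q P X i) := by
  intro c hc
  obtain ⟨hb, hbO, hbO'⟩ := hX _ (exists_not_dvd_reciprocalCoeffs hℓ hQ hi hc)
  obtain ⟨hP, hPO, hPO'⟩ := hO (P i) hi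
  rw [sum_mul_reciprocalForms Q c X hP]
  refine ⟨mul_ne_zero (inv_ne_zero hP) hb, mul_mem hPO' hbO, ?_⟩
  rw [mul_inv, inv_inv]
  exact mul_mem hPO hbO'

theorem Unimodular.isUnitIn_sub_mul_div (hX : Unimodular O ℓ X) (hℓ : ℓ.Prime)
    (hO : ∀ m : ℕ, ¬ ℓ ∣ m → IsUnitIn O (m : K)) {P : ι → ℕ} {i j : ι} (hij : i ≠ j)
    (hi : ¬ ℓ ∣ P i) : IsUnitIn O (X j - P j * X i / P i) := by
  classical
  have hunit := (hX.unimodular_reciprocalForms hℓ hO hℓ.not_dvd_one hi).isUnitIn hℓ j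
  rwa [reciprocalForms, Function.update_of_ne hij.symm] at hunit

end Unimodular

section CothIntegrality

open Finset

variable {K : Type*} [Field K]

/-- The Laurent series whose `k`-th coefficient is carried into `O` by `c`. -/
def integralAt (O : Subring K) (c : K) (k : ℤ) : AddSubgroup (LaurentSeries K) where
  carrier := {f | c * f.coeff k ∈ O}
  add_mem' {f g} hf hg := by
    simp only [Set.mem_ofPred_eq, HahnSeries.coeff_add, mul_add] at *
    exact add_mem hf hg
  zero_mem' := by simp
  neg_mem' {f} hf := by
    simp only [Set.mem_ofPred_eq, HahnSeries.coeff_neg, mul_neg] at *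
    exact neg_mem hf

variable {O : Subring K} {c : K}

theorem mem_integralAt {k : ℤ} {f : LaurentSeries K} :
    f ∈ integralAt O c k ↔ c * f.coeff k ∈ O := Iff.rfl

theorem C_mul_mem_integralAt {k : ℤ} {f : LaurentSeries K} {a : K} (ha : a ∈ O)
    (hf : f ∈ integralAt O c k) : HahnSeries.C a * f ∈ integralAt O c k := by
  rw [mem_integralAt, HahnSeries.C_mul_eq_smul, HahnSeries.coeff_smul, smul_eq_mul,
    mul_left_comm]
  exact mul_mem ha hf

variable [CharZero K] {ι : Type*} [Fintype ι] {N : ℕ}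

/-- `c` clears the denominators of the coefficients of total degree `N` of the products
of series `z * cothFun (exp z)` and `z / 2`. -/
def ClearsCoth (O : Subring K) (ι : Type*) [Fintype ι] (N : ℕ) (c : K) : Prop :=
  ∀ m : ι → ℕ, ∑ i, m i = N → ∀ t : ι → K,
    (∀ i, t i = cothCoeff (m i) ∨ t i = if m i = 1 then 1 / 2 else 0) → c * ∏ i, t i ∈ O

theorem single_mul_one_half :
    HahnSeries.single (1 : ℤ) (1 : K) * (1 / 2 : LaurentSeries K) =
      HahnSeries.ofPowerSeries ℤ K (PowerSeries.mk fun m => if m = 1 then 1 / 2 else 0) := by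
  have hmk : (PowerSeries.mk fun m => if m = 1 then (1 / 2 : K) else 0) =
      PowerSeries.C (1 / 2) * PowerSeries.X := by
    ext m
    rw [PowerSeries.coeff_mk, PowerSeries.coeff_C_mul, PowerSeries.coeff_X, mul_ite, mul_one,
      mul_zero]
  have hhalf : (HahnSeries.C (1 / 2 : K) : LaurentSeries K) = 1 / 2 :=
    eq_div_of_mul_eq two_ne_zero (by
      rw [← map_ofNat (HahnSeries.C : K →+* LaurentSeries K) 2, ← map_mul,
        div_mul_cancel₀ _ two_ne_zero, map_one])
  rw [hmk, map_mul, HahnSeries.ofPowerSeries_C, HahnSeries.ofPowerSeries_X, hhalf, mul_comm]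

theorem prod_mem_integralAt (hc : ClearsCoth O ι N c) {g : ι → LaurentSeries K}
    (hg : ∀ i, g i = 1 / 2 ∨ ∃ y, IsUnitIn O y ∧ g i = cothFun (expLaurent y)) :
    ∏ i, g i ∈ integralAt O c ((N : ℤ) - Fintype.card ι) := by
  classical
  have hexpand : ∀ i, ∃ t v : ℕ → K, HahnSeries.single (1 : ℤ) (1 : K) * g i =
      HahnSeries.ofPowerSeries ℤ K (PowerSeries.mk fun m => t m * v m) ∧ (∀ m, v m ∈ O) ∧
      ∀ m, t m = cothCoeff m ∨ t m = if m = 1 then 1 / 2 else 0 := by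
    intro i
    rcases hg i with h | ⟨y, hy, h⟩
    · refine ⟨fun m => if m = 1 then 1 / 2 else 0, 1, ?_, fun _ => one_mem _, fun _ => Or.inr rfl⟩
      simp only [h, single_mul_one_half, Pi.one_apply, mul_one]
    · exact ⟨fun m => cothCoeff m, fun m => y ^ ((m : ℤ) - 1),
        by rw [h, single_mul_cothFun_expLaurent hy.1], fun m => hy.zpow_mem _, fun _ => Or.inl rfl⟩
  choose t v hg' hv ht using hexpand
  rw [mem_integralAt, coeff_prod_of_single_mul hg', mul_sum]
  refine sum_mem fun m hm => ?_
  simp only [PowerSeries.coeff_mk, prod_mul_distrib]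
  rw [← mul_assoc]
  exact mul_mem (hc m (by simpa using hm) _ fun i => ht i (m i)) (prod_mem fun i _ => hv i _)

theorem cothBoundary_eq_zero_or_eq_prod (P : ι → ℕ) (X : ι → K) :
    cothBoundary P X = 0 ∨ cothBoundary P X = ∏ i, cothFunAtInfty (P i) (expLaurent (X i)) := by
  have hzero : ∏ i, cothFunAtZero (P i) (expLaurent (X i)) =
      (-1) ^ #{i | P i ≠ 0} * ∏ i, cothFunAtInfty (P i) (expLaurent (X i)) := by
    rw [card_filter, ← prod_pow_eq_pow_sum, ← prod_mul_distrib]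
    refine prod_congr rfl fun i _ => ?_
    by_cases h : P i = 0 <;> simp [cothFunAtZero, cothFunAtInfty, h]
  rw [cothBoundary, hzero]
  rcases neg_one_pow_eq_or (LaurentSeries K) #{i | P i ≠ 0} with h | h <;> rw [h]
  · exact Or.inr (by ring)
  · exact Or.inl (by ring)

theorem cothBoundary_mem_integralAt (hc : ClearsCoth O ι N c) (P : ι → ℕ)
    {X : ι → K} (hX : ∀ i, IsUnitIn O (X i)) :
    cothBoundary P X ∈ integralAt O c ((N : ℤ) - Fintype.card ι) := by
  rcases cothBoundary_eq_zero_or_eq_prod P X with h | h <;> rw [h]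
  · exact zero_mem _
  · refine prod_mem_integralAt hc fun i => ?_
    rw [cothFunAtInfty]
    split_ifs
    · exact Or.inr ⟨X i, hX i, rfl⟩
    · exact Or.inl rfl

/-- Since `cothFun` is odd, a weight may be reduced modulo `Q` and then, if it is a multiple of `ℓ`,
replaced by its complement to `Q`. -/
theorem exists_normalized_weight {ℓ Q : ℕ} (hQ : ¬ ℓ ∣ Q) (p : ℕ) {x : K} (hx : x ≠ 0) :
    ∃ (p' : ℕ) (ε : ℤˣ), p' < Q ∧ (p' = 0 ∨ ¬ ℓ ∣ p') ∧
      ∀ w : K, w ^ Q = 1 → cothFun (HahnSeries.C (w ^ p) * expLaurent x) =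
        ((ε : ℤ) : LaurentSeries K) *
          cothFun (HahnSeries.C (w ^ p') * expLaurent (((ε : ℤ) : K) * x)) := by
  have hQ0 : Q ≠ 0 := fun h => hQ (h ▸ dvd_zero ℓ)
  have hlt := Nat.mod_lt p (Nat.pos_of_ne_zero hQ0)
  by_cases h : p % Q = 0 ∨ ¬ ℓ ∣ p % Q
  · refine ⟨p % Q, 1, hlt, h, fun w hw => ?_⟩
    rw [pow_eq_pow_mod p hw]
    simp
  · push Not at h
    refine ⟨Q - p % Q, -1, by omega, Or.inr fun hdvd => hQ ?_, fun w hw => ?_⟩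
    · simpa only [Nat.sub_add_cancel hlt.le] using dvd_add hdvd h.2
    · have hw0 : w ≠ 0 := by
        rintro rfl
        exact zero_ne_one ((zero_pow hQ0).symm.trans hw)
      have hpow : w ^ p = (w ^ (Q - p % Q))⁻¹ := by
        refine eq_inv_of_mul_eq_one_left ?_
        rw [pow_eq_pow_mod p hw, ← pow_add, Nat.add_sub_cancel' hlt.le, hw]
      have hinv : HahnSeries.C (w ^ p) * expLaurent x =
          (HahnSeries.C (w ^ (Q - p % Q)) * expLaurent (-x))⁻¹ := by
        rw [hpow, expLaurent_neg, mul_inv, inv_inv, map_inv₀]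
      rw [hinv, cothFun_inv]
      · simp
      · exact mul_ne_zero ((map_ne_zero_iff _ HahnSeries.C_injective).2 (pow_ne_zero _ hw0))
          (expLaurent_ne_zero _)
      · exact C_mul_expLaurent_ne_one (pow_ne_zero _ hw0) (neg_ne_zero.2 hx)

theorem exists_normalized_cothSum {ℓ Q : ℕ} (hQ : ¬ ℓ ∣ Q) (P : ι → ℕ) {X : ι → K}
    (hX : ∀ i, X i ≠ 0) :
    ∃ (P' : ι → ℕ) (ε : ι → ℤˣ), (∀ i, P' i < Q ∧ (P' i = 0 ∨ ¬ ℓ ∣ P' i)) ∧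
      cothSum Q P X =
        HahnSeries.C (∏ i, ((ε i : ℤ) : K)) * cothSum Q P' fun i => ((ε i : ℤ) : K) * X i := by
  have hQ0 : 0 < Q := Nat.pos_of_ne_zero fun h => hQ (h ▸ dvd_zero ℓ)
  choose P' ε hlt hP' hcoth using fun i => exists_normalized_weight hQ (P i) (hX i)
  refine ⟨P', ε, fun i => ⟨hlt i, hP' i⟩, ?_⟩
  rw [cothSum, cothSum, mul_sum]
  refine sum_congr rfl fun w hw => ?_
  rw [prod_congr rfl fun i _ => hcoth i w ((Polynomial.mem_nthRootsFinset hQ0 1).1 hw),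
    prod_mul_distrib, map_prod]
  simp only [map_intCast]

variable [IsAlgClosed K]

theorem cothSum_eq_C_mul_sub [DecidableEq ι] {Q : ℕ} (hQ : Q ≠ 0) {P : ι → ℕ} {X : ι → K}
    (hX : ∀ i, X i ≠ 0) (hXX : ∀ i j, i ≠ j → P i ≠ 0 → X j - P j * X i / P i ≠ 0) :
    cothSum Q P X = HahnSeries.C (Q : K) * (cothBoundary P X - ∑ i, HahnSeries.C (P i : K)⁻¹ *
      cothSum (P i) (Function.update P i Q) (reciprocalForms Q P X i)) := by
  have hQL : (Q : LaurentSeries K) ≠ 0 := by exact_mod_cast hQ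
  simp only [map_inv₀, map_natCast]
  rw [← cothSum_reciprocity hQ hX hXX, add_sub_cancel_right, mul_inv_cancel_left₀ hQL]

/-- Normalizing the weights to be less than the modulus and applying reciprocity is a step of
Euclid's algorithm, so that induction on the modulus applies. -/
theorem cothSum_mem_integralAt {ℓ : ℕ} (hℓ : ℓ.Prime)
    (hO : ∀ m : ℕ, ¬ ℓ ∣ m → IsUnitIn O (m : K)) (hc : ClearsCoth O ι N c) {Q : ℕ} (hQ : ¬ ℓ ∣ Q)
    (P : ι → ℕ) {X : ι → K} (hX : Unimodular O ℓ X) :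
    cothSum Q P X ∈ integralAt O c ((N : ℤ) - Fintype.card ι) := by
  classical
  induction Q using Nat.strong_induction_on generalizing P X with
  | _ Q ih =>
  have hQ0 : Q ≠ 0 := fun h => hQ (h ▸ dvd_zero ℓ)
  obtain ⟨P', ε, hP', hsum⟩ := exists_normalized_cothSum hQ P fun i => (hX.isUnitIn hℓ i).1
  have hεX := hX.units_mul ε
  have hP'0 : ∀ i, P' i ≠ 0 → ¬ ℓ ∣ P' i := fun i hi => (hP' i).2.resolve_left hi
  rw [hsum, cothSum_eq_C_mul_sub hQ0 (fun i => (hεX.isUnitIn hℓ i).1)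
    fun i j hij hi => (hεX.isUnitIn_sub_mul_div hℓ hO hij (hP'0 i hi)).1]
  refine C_mul_mem_integralAt (prod_mem fun i _ => intCast_mem _ _)
    (C_mul_mem_integralAt (natCast_mem _ _) (sub_mem
      (cothBoundary_mem_integralAt hc P' (hεX.isUnitIn hℓ)) (sum_mem fun i _ => ?_)))
  rcases eq_or_ne (P' i) 0 with hi | hi
  · rw [hi, Nat.cast_zero, inv_zero, map_zero, zero_mul]
    exact zero_mem _
  · exact C_mul_mem_integralAt (hO _ (hP'0 i hi)).2.2 (ih (P' i) (hP' i).1 (hP'0 i hi) _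
      (hεX.unimodular_reciprocalForms hℓ hO hQ (hP'0 i hi)))

end CothIntegrality

section LocalizationAtPrime

variable {R K : Type*} [CommRing R] [Field K]

/-- The localization of `R` at the prime ideal generated by `π`, as a subring of a field. -/
def localizationAtPrime (f : R →+* K) {π : R} (hπ : Prime π) : Subring K where
  carrier := {y | ∃ a b : R, ¬ π ∣ b ∧ y * f b = f a}
  zero_mem' := ⟨0, 1, hπ.not_dvd_one, by simp⟩
  one_mem' := ⟨1, 1, hπ.not_dvd_one, by simp⟩
  add_mem' := by
    rintro y z ⟨a, b, hb, h⟩ ⟨a', b', hb', h'⟩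
    refine ⟨a * b' + a' * b, b * b', fun hd => (hπ.dvd_or_dvd hd).elim hb hb', ?_⟩
    simp only [map_mul, map_add]
    linear_combination f b' * h + f b * h'
  mul_mem' := by
    rintro y z ⟨a, b, hb, h⟩ ⟨a', b', hb', h'⟩
    refine ⟨a * a', b * b', fun hd => (hπ.dvd_or_dvd hd).elim hb hb', ?_⟩
    simp only [map_mul]
    linear_combination z * f b' * h + f a * h'
  neg_mem' := by
    rintro y ⟨a, b, hb, h⟩
    refine ⟨-a, b, hb, ?_⟩
    rw [map_neg]
    linear_combination -h

variable {f : R →+* K} {π : R} {hπ : Prime π}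

theorem mem_localizationAtPrime {y : K} :
    y ∈ localizationAtPrime f hπ ↔ ∃ a b : R, ¬ π ∣ b ∧ y * f b = f a := Iff.rfl

theorem isUnitIn_localizationAtPrime (hf : Function.Injective f) {b : R} (hb : ¬ π ∣ b) :
    IsUnitIn (localizationAtPrime f hπ) (f b) := by
  have hfb : f b ≠ 0 := (map_ne_zero_iff f hf).2 fun h => hb (h ▸ dvd_zero π)
  exact ⟨hfb, ⟨b, 1, hπ.not_dvd_one, by rw [map_one, mul_one]⟩,
    ⟨1, b, hb, by rw [map_one, inv_mul_cancel₀ hfb]⟩⟩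

end LocalizationAtPrime

section RationalsAt

/-- The rational numbers that are integral at `ℓ`. -/
def rationalsAt {ℓ : ℕ} (hℓ : ℓ.Prime) : Subring ℚ :=
  localizationAtPrime (Int.castRingHom ℚ) (Nat.prime_iff_prime_int.1 hℓ)

variable {ℓ : ℕ} {hℓ : ℓ.Prime}

theorem mem_rationalsAt {y : ℚ} :
    y ∈ rationalsAt hℓ ↔ ∃ a b : ℤ, ¬ (ℓ : ℤ) ∣ b ∧ y * b = a := Iff.rfl

theorem isUnitIn_rationalsAt_natCast {m : ℕ} (hm : ¬ ℓ ∣ m) :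
    IsUnitIn (rationalsAt hℓ) (m : ℚ) := by
  simpa [rationalsAt] using
    isUnitIn_localizationAtPrime (f := Int.castRingHom ℚ) (hπ := Nat.prime_iff_prime_int.1 hℓ)
      Int.cast_injective (mt Int.natCast_dvd_natCast.1 hm)

theorem not_dvd_den_of_mem_rationalsAt {y : ℚ} (hy : y ∈ rationalsAt hℓ) : ¬ ℓ ∣ y.den := by
  obtain ⟨a, b, hb, hab⟩ := mem_rationalsAt.1 hy
  intro hd
  have hcross : y.num * b = a * y.den := by
    have hnum : y * y.den = y.num := Rat.mul_den_eq_num y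
    have hcast : (y.num : ℚ) * b = a * y.den := by rw [← hnum, ← hab]; ring
    exact_mod_cast hcast
  have hdvd : (ℓ : ℤ) ∣ y.num * b := hcross ▸ (Int.natCast_dvd_natCast.2 hd).mul_left a
  have hnum : ℓ ∣ y.num.natAbs :=
    Int.natCast_dvd.1 (((Nat.prime_iff_prime_int.1 hℓ).dvd_or_dvd hdvd).resolve_right hb)
  exact hℓ.not_dvd_one (y.reduced ▸ Nat.dvd_gcd hnum hd)

theorem exists_int_eq_of_forall_mem_rationalsAt {y : ℚ}
    (h : ∀ (ℓ : ℕ) (hℓ : ℓ.Prime), y ∈ rationalsAt hℓ) : ∃ a : ℤ, (a : ℚ) = y := by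
  have hden : y.den = 1 := by
    by_contra hne
    obtain ⟨ℓ, hℓ, hd⟩ := Nat.exists_prime_and_dvd hne
    exact not_dvd_den_of_mem_rationalsAt (h ℓ hℓ) hd
  exact ⟨y.num, Rat.coe_int_num_of_den_eq_one hden⟩

theorem intModEq_of_forall_mem_rationalsAt {a b : ℤ} {q : ℕ} (hq : q ≠ 0)
    (h : ∀ (ℓ : ℕ) (hℓ : ℓ.Prime), ℓ ∣ q → ((a - b : ℤ) : ℚ) / q ∈ rationalsAt hℓ) :
    a ≡ b [ZMOD q] := by
  obtain ⟨k, hk⟩ := exists_int_eq_of_forall_mem_rationalsAt (y := ((a - b : ℤ) : ℚ) / q)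
    fun ℓ hℓ => by
      by_cases hdvd : ℓ ∣ q
      · exact h ℓ hℓ hdvd
      · exact mul_mem (intCast_mem _ _) (isUnitIn_rationalsAt_natCast hdvd).2.2
  rw [eq_div_iff (by exact_mod_cast hq)] at hk
  refine (Int.modEq_iff_dvd.2 ⟨k, ?_⟩).symm
  rw [mul_comm]
  exact_mod_cast hk.symm

end RationalsAt

section GaussSubring

open MvPolynomial

variable {K : Type*} [Field K] [CharZero K] {ι : Type*}

theorem prime_C_natCast (ι : Type*) {ℓ : ℕ} (hℓ : ℓ.Prime) :
    Prime (C (ℓ : ℤ) : MvPolynomial ι ℤ) :=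
  (prime_C_iff ι).2 (Nat.prime_iff_prime_int.1 hℓ)

/-- The localization of `ℤ[x]` at the prime `ℓ`, for a family `x` in a field. -/
noncomputable def gaussSubring {ℓ : ℕ} (hℓ : ℓ.Prime) (x : ι → K) : Subring K :=
  localizationAtPrime (aeval x : MvPolynomial ι ℤ →ₐ[ℤ] K).toRingHom (prime_C_natCast ι hℓ)

theorem injective_aeval_int {x : ι → K} (hx : AlgebraicIndependent ℚ x) :
    Function.Injective (aeval x : MvPolynomial ι ℤ →ₐ[ℤ] K).toRingHom :=
  hx.restrictScalars (R := ℤ) Int.cast_injective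

variable {ℓ : ℕ} {hℓ : ℓ.Prime} {x : ι → K}

theorem isUnitIn_gaussSubring_natCast (hx : AlgebraicIndependent ℚ x) {m : ℕ} (hm : ¬ ℓ ∣ m) :
    IsUnitIn (gaussSubring hℓ x) (m : K) := by
  have hC : ¬ (C (ℓ : ℤ) : MvPolynomial ι ℤ) ∣ C (m : ℤ) := by
    rw [C_dvd_iff_dvd_coeff]
    intro h
    exact hm (Int.natCast_dvd_natCast.1 (by simpa only [coeff_zero_C] using h 0))
  simpa [gaussSubring] using
    isUnitIn_localizationAtPrime (hπ := prime_C_natCast ι hℓ) (injective_aeval_int hx) hC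

theorem ratCast_mem_gaussSubring (hx : AlgebraicIndependent ℚ x) {y : ℚ}
    (hy : y ∈ rationalsAt hℓ) : (y : K) ∈ gaussSubring hℓ x := by
  rw [Rat.cast_def, div_eq_mul_inv]
  exact mul_mem (intCast_mem _ _)
    (isUnitIn_gaussSubring_natCast hx (not_dvd_den_of_mem_rationalsAt hy)).2.2

theorem unimodular_gaussSubring [Fintype ι] (hx : AlgebraicIndependent ℚ x) :
    Unimodular (gaussSubring hℓ x) ℓ x := by
  classical
  rintro c ⟨i, hi⟩
  have hform : ¬ (C (ℓ : ℤ) : MvPolynomial ι ℤ) ∣ ∑ j, C (c j) * X j := by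
    rw [C_dvd_iff_dvd_coeff]
    intro h
    have hcoeff := h (Finsupp.single i 1)
    simp only [coeff_sum, coeff_C_mul, coeff_X, Finsupp.single_left_inj one_ne_zero, mul_ite,
      mul_one, mul_zero, Finset.sum_ite_eq', Finset.mem_univ, if_true] at hcoeff
    exact hi hcoeff
  simpa [gaussSubring] using
    isUnitIn_localizationAtPrime (hπ := prime_C_natCast ι hℓ) (injective_aeval_int hx) hform

theorem exists_C_natCast_mul_eq_map (g : MvPolynomial ι ℚ) :
    ∃ (M : ℕ) (G : MvPolynomial ι ℤ), M ≠ 0 ∧ C (M : ℚ) * g = map (Int.castRingHom ℚ) G := by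
  induction g using MvPolynomial.induction_on' with
  | monomial m a =>
    refine ⟨a.den, monomial m a.num, a.den_ne_zero, ?_⟩
    rw [C_mul_monomial, map_monomial, mul_comm, Rat.mul_den_eq_num]
    rfl
  | add p q hp hq =>
    obtain ⟨M, G, hM, h⟩ := hp
    obtain ⟨M', G', hM', h'⟩ := hq
    refine ⟨M * M', C (M' : ℤ) * G + C (M : ℤ) * G', mul_ne_zero hM hM', ?_⟩
    simp only [map_add, map_mul, ← h, ← h', map_C, Nat.cast_mul, Int.coe_castRingHom,
      Int.cast_natCast]
    ring

theorem coeff_mem_rationalsAt_of_mul_map_eq_map {g : MvPolynomial ι ℚ} {a b : MvPolynomial ι ℤ}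
    (hb : ¬ C (ℓ : ℤ) ∣ b) (h : g * map (Int.castRingHom ℚ) b = map (Int.castRingHom ℚ) a)
    (m : ι →₀ ℕ) : g.coeff m ∈ rationalsAt hℓ := by
  obtain ⟨M, G, hM, hG⟩ := exists_C_natCast_mul_eq_map g
  obtain ⟨k, M', hM', rfl⟩ := Nat.exists_eq_pow_mul_and_not_dvd hM ℓ hℓ.ne_one
  have hGb : G * b = C (ℓ : ℤ) ^ k * (C (M' : ℤ) * a) := by
    apply map_injective _ (RingHom.injective_int (Int.castRingHom ℚ))
    rw [map_mul, map_mul, map_mul, ← h, ← hG, map_pow, map_C, map_C]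
    simp only [eq_intCast, Int.cast_natCast, Nat.cast_mul, Nat.cast_pow, map_mul, map_pow]
    ring
  obtain ⟨G', rfl⟩ := (prime_C_natCast ι hℓ).pow_dvd_of_dvd_mul_right k hb ⟨_, hGb⟩
  have hcoeff := congrArg (coeff m) hG
  rw [coeff_C_mul, coeff_map, ← map_pow, coeff_C_mul] at hcoeff
  refine ⟨G'.coeff m, M', mt Int.natCast_dvd_natCast.1 hM', ?_⟩
  have hℓ0 : (ℓ : ℚ) ^ k ≠ 0 := pow_ne_zero _ (by exact_mod_cast hℓ.ne_zero)
  refine mul_left_cancel₀ hℓ0 ?_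
  push_cast at hcoeff ⊢
  simp only [eq_intCast, Int.cast_mul, Int.cast_pow, Int.cast_natCast] at hcoeff
  linear_combination hcoeff

theorem coeff_mem_of_aeval_mem_gaussSubring (hx : AlgebraicIndependent ℚ x)
    {g : MvPolynomial ι ℚ} (hg : aeval x g ∈ gaussSubring hℓ x) (m : ι →₀ ℕ) :
    g.coeff m ∈ rationalsAt hℓ := by
  obtain ⟨a, b, hb, h⟩ := mem_localizationAtPrime.1 hg
  have hmap : ∀ p : MvPolynomial ι ℤ, (aeval x : MvPolynomial ι ℤ →ₐ[ℤ] K).toRingHom p =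
      aeval x (map (Int.castRingHom ℚ) p) := fun p => by
    simpa using (aeval_map_algebraMap (R := ℤ) ℚ x p).symm
  refine coeff_mem_rationalsAt_of_mul_map_eq_map hb (a := a) (hx ?_) m
  rw [map_mul, ← hmap, ← hmap, h]

end GaussSubring

section ResidueAtInfinity

open Finset Polynomial

variable {K : Type*} [Field K] {J : Type*} [DecidableEq J]

theorem eval_div_eval_nodal {s : Finset J} {v : J → K} (hv : Set.InjOn v s) (A : K[X]) {T : K}
    (hT : ∀ i ∈ s, T ≠ v i) :
    A.eval T / (Lagrange.nodal s v).eval T =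
      (A /ₘ Lagrange.nodal s v).eval T +
        ∑ i ∈ s, Lagrange.nodalWeight s v i * A.eval (v i) * (T - v i)⁻¹ := by
  have hnodal : (Lagrange.nodal s v).eval T ≠ 0 := by
    rw [Lagrange.eval_nodal]
    exact prod_ne_zero_iff.2 fun i hi => sub_ne_zero.2 (hT i hi)
  have hrem : A %ₘ Lagrange.nodal s v = Lagrange.interpolate s v fun i => A.eval (v i) := by
    refine Lagrange.eq_interpolate_of_eval_eq _ hv ?_ fun i hi => ?_
    · rw [← Lagrange.degree_nodal (s := s) (v := v)]
      exact degree_modByMonic_lt _ (Lagrange.nodal_monic)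
    · conv_rhs => rw [← modByMonic_add_div A (Lagrange.nodal s v), eval_add, eval_mul,
        Lagrange.eval_nodal_at_node hi, zero_mul, add_zero]
  conv_lhs => rw [← modByMonic_add_div A (Lagrange.nodal s v), hrem, eval_add, eval_mul,
    Lagrange.eval_interpolate_not_at_node _ hT, add_div, mul_div_cancel_left₀ _ hnodal,
    mul_div_cancel_left₀ _ hnodal, add_comm]
  exact congrArg _ (sum_congr rfl fun i _ => by ring)

theorem eval₂_mul_prod_inv {L : Type*} [Field L] (φ : K →+* L) {s : Finset J} {v : J → K}
    (hv : Set.InjOn v s) (A : K[X]) {T : L} (hT : ∀ i ∈ s, T ≠ φ (v i)) :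
    A.eval₂ φ T * ∏ i ∈ s, (T - φ (v i))⁻¹ =
      (A /ₘ Lagrange.nodal s v).eval₂ φ T +
        ∑ i ∈ s, φ (Lagrange.nodalWeight s v i * A.eval (v i)) * (T - φ (v i))⁻¹ := by
  have hnodal : Lagrange.nodal s (φ ∘ v) = (Lagrange.nodal s v).map φ := by
    simp [Lagrange.nodal, Polynomial.map_prod]
  have hpole := eval_div_eval_nodal (φ.injective.comp_injOn hv) (A.map φ) hT
  rw [Lagrange.eval_nodal, div_eq_mul_inv, ← prod_inv_distrib, hnodal,
    ← map_divByMonic _ Lagrange.nodal_monic, eval_map, eval_map] at hpole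
  refine hpole.trans (congrArg _ (sum_congr rfl fun i _ => ?_))
  simp only [Lagrange.nodalWeight, Function.comp_apply, eval_map, eval₂_hom, map_mul, map_prod,
    map_inv₀, map_sub]

theorem single_neg_one_sub_C_ne_zero (a : K) :
    (HahnSeries.single (-1) 1 - HahnSeries.C a : LaurentSeries K) ≠ 0 := by
  intro h
  have hcoeff := congrArg (fun f => HahnSeries.coeff f (-1)) h
  simp [HahnSeries.C_apply] at hcoeff

theorem coeff_zero_inv_single_neg_one_sub_C (a : K) :
    ((HahnSeries.single (-1) 1 - HahnSeries.C a : LaurentSeries K)⁻¹).coeff 0 = 0 := by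
  have hinv : (HahnSeries.single (-1) 1 - HahnSeries.C a : LaurentSeries K)⁻¹ =
      HahnSeries.ofPowerSeries ℤ K (PowerSeries.X * (1 - PowerSeries.C a * PowerSeries.X)⁻¹) := by
    have hgeom : (1 - PowerSeries.C a * PowerSeries.X) *
        (1 - PowerSeries.C a * PowerSeries.X)⁻¹ = (1 : PowerSeries K) :=
      PowerSeries.mul_inv_cancel _ (by simp)
    have hX : (HahnSeries.single (-1) 1 - HahnSeries.C a : LaurentSeries K) *
        HahnSeries.ofPowerSeries ℤ K PowerSeries.X =
          HahnSeries.ofPowerSeries ℤ K (1 - PowerSeries.C a * PowerSeries.X) := by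
      simp [HahnSeries.ofPowerSeries_X, sub_mul, HahnSeries.C_apply]
    refine inv_eq_of_mul_eq_one_right ?_
    rw [map_mul, ← mul_assoc, hX, ← map_mul, hgeom, map_one]
  have hcoeff := HahnSeries.ofPowerSeries_apply_coeff (Γ := ℤ)
    (PowerSeries.X * (1 - PowerSeries.C a * PowerSeries.X)⁻¹ : PowerSeries K) 0
  rw [hinv]
  simpa using hcoeff

theorem coeff_zero_eval₂_single_neg_one (B : K[X]) :
    (B.eval₂ HahnSeries.C (HahnSeries.single (-1) 1 : LaurentSeries K)).coeff 0 = B.eval 0 := by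
  rw [eval₂_eq_sum_range, HahnSeries.coeff_sum, ← coeff_zero_eq_eval_zero,
    sum_eq_single_of_mem 0 (mem_range.2 (Nat.succ_pos _))]
  · rw [pow_zero, mul_one, HahnSeries.C_apply, HahnSeries.coeff_single_same]
  · intro k _ hk
    rw [HahnSeries.single_pow, HahnSeries.C_mul_eq_smul, HahnSeries.coeff_smul,
      HahnSeries.coeff_single_of_ne, smul_zero]
    simpa using hk

/-- With `T` the inverse of the Laurent parameter, this is the residue theorem for
`A(T) / (T * ∏ (T - v i))`. -/
theorem coeff_zero_eval₂_mul_prod {s : Finset J} {v : J → K} (hv : Set.InjOn v s)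
    (hv0 : ∀ i ∈ s, v i ≠ 0) (A : K[X]) :
    (A.eval₂ HahnSeries.C (HahnSeries.single (-1) 1 : LaurentSeries K) *
        ∏ i ∈ s, (HahnSeries.single (-1) 1 - HahnSeries.C (v i))⁻¹).coeff 0 =
      A.eval 0 * ∏ i ∈ s, (0 - v i)⁻¹ +
        ∑ i ∈ s, Lagrange.nodalWeight s v i * A.eval (v i) * (v i)⁻¹ := by
  have hatzero := eval₂_mul_prod_inv (RingHom.id K) hv A fun i hi => (hv0 i hi).symm
  simp only [RingHom.id_apply, eval₂_id] at hatzero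
  rw [hatzero, eval₂_mul_prod_inv _ hv A fun i _ =>
      sub_ne_zero.1 (single_neg_one_sub_C_ne_zero _), HahnSeries.coeff_add, HahnSeries.coeff_sum,
    coeff_zero_eval₂_single_neg_one, add_assoc, ← sum_add_distrib]
  congr 1
  refine (sum_eq_zero fun i _ => ?_).trans (sum_eq_zero fun i _ => ?_).symm
  · rw [HahnSeries.C_mul_eq_smul, HahnSeries.coeff_smul, coeff_zero_inv_single_neg_one_sub_C,
      smul_zero]
  · rw [zero_sub, inv_neg, mul_neg, neg_add_cancel]

end ResidueAtInfinity

section PartialFractions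

open Finset Polynomial

variable {K : Type*} [Field K] {ι : Type*} [Fintype ι]

theorem zpow_natCast_sub_one_eq_ite (y : K) (m : ℕ) :
    y ^ ((m : ℤ) - 1) = if m = 0 then y⁻¹ else y ^ (m - 1) := by
  rcases m with _ | m
  · simp
  · simp

/-- The numerator of `∏ i, (p i * T + x i) ^ (m i - 1)`, as a polynomial in `T`, over the product
of the factors `T + x i / p i` with `m i = 0`. -/
noncomputable def linearNumerator (p x : ι → K) (m : ι → ℕ) : K[X] :=
  ∏ i, if m i = 0 then C (p i)⁻¹ else (C (p i) * X + C (x i)) ^ (m i - 1)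

theorem eval₂_linearNumerator_mul_prod {L : Type*} [Field L] (φ : K →+* L) {p : ι → K}
    (hp : ∀ i, p i ≠ 0) (x : ι → K) (m : ι → ℕ) (T : L) :
    (linearNumerator p x m).eval₂ φ T * ∏ i with m i = 0, (T - φ (-(x i / p i)))⁻¹ =
      ∏ i, (φ (p i) * T + φ (x i)) ^ ((m i : ℤ) - 1) := by
  rw [linearNumerator, eval₂_finsetProd, prod_filter, ← prod_mul_distrib]
  refine prod_congr rfl fun i _ => ?_
  rw [zpow_natCast_sub_one_eq_ite]
  split_ifs
  · have hφ : φ (p i) ≠ 0 := (map_ne_zero φ).2 (hp i)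
    rw [eval₂_C, map_inv₀, ← mul_inv, map_neg, map_div₀]
    congr 1
    field_simp
    ring
  · simp only [eval₂_pow, eval₂_add, eval₂_mul, eval₂_C, eval₂_X, mul_one]

variable [DecidableEq ι]

theorem nodalWeight_mul_eval_linearNumerator {p : ι → K} (hp : ∀ i, p i ≠ 0) (x : ι → K)
    {m : ι → ℕ} {i : ι} (hi : m i = 0) :
    Lagrange.nodalWeight (univ.filter fun i => m i = 0) (fun i => -(x i / p i)) i *
        (linearNumerator p x m).eval (-(x i / p i)) =
      (p i)⁻¹ * ∏ j ∈ univ.erase i, (x j - p j * x i / p i) ^ ((m j : ℤ) - 1) := by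
  rw [Lagrange.nodalWeight, ← filter_erase, prod_filter, linearNumerator, eval_prod,
    ← mul_prod_erase univ _ (mem_univ i), if_pos hi, eval_C, mul_left_comm, ← prod_mul_distrib]
  congr 1
  refine prod_congr rfl fun j _ => ?_
  have hpi := hp i
  have hpj := hp j
  rw [zpow_natCast_sub_one_eq_ite]
  split_ifs
  · rw [eval_C, ← mul_inv]
    congr 1
    field_simp
    ring
  · simp only [eval_pow, eval_add, eval_mul, eval_C, eval_X, one_mul]
    congr 1
    ring

theorem coeff_zero_prod_linear {p x : ι → K} (hp : ∀ i, p i ≠ 0) (hx : ∀ i, x i ≠ 0)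
    (hxx : ∀ i j, i ≠ j → x j - p j * x i / p i ≠ 0) (m : ι → ℕ) :
    (∏ i, (HahnSeries.C (p i) * HahnSeries.single (-1) 1 + HahnSeries.C (x i) : LaurentSeries K) ^
        ((m i : ℤ) - 1)).coeff 0 =
      ∏ i, x i ^ ((m i : ℤ) - 1) - ∑ i with m i = 0,
        (x i)⁻¹ * ∏ j ∈ univ.erase i, (x j - p j * x i / p i) ^ ((m j : ℤ) - 1) := by
  have hinj : Function.Injective fun i => -(x i / p i) := by
    intro i j h
    by_contra hij
    refine hxx i j hij ?_
    have hpj := hp j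
    have hratio : x i / p i = x j / p j := neg_injective h
    rw [mul_div_assoc, hratio, mul_div_cancel₀ _ hpj, sub_self]
  have hatzero := eval₂_linearNumerator_mul_prod (RingHom.id K) hp x m 0
  simp only [RingHom.id_apply, mul_zero, zero_add] at hatzero
  rw [← eval₂_linearNumerator_mul_prod _ hp,
    coeff_zero_eval₂_mul_prod hinj.injOn fun i _ => neg_ne_zero.2 (div_ne_zero (hx i) (hp i)),
    ← hatzero, sub_eq_add_neg, ← sum_neg_distrib]
  congr 1
  refine sum_congr rfl fun i hi => ?_
  rw [nodalWeight_mul_eval_linearNumerator hp x (mem_filter.1 hi).2]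
  rw [inv_neg, inv_div, mul_neg, mul_right_comm, div_eq_mul_inv, inv_mul_cancel_left₀ (hp i)]

end PartialFractions

section ShiftedBinomial

open Finset

/-- The `r`-th coefficient of the power series `z * (a + z) ^ (m - 1)`. -/
noncomputable def shiftedBinomial (a : ℚ) (m r : ℕ) : ℚ :=
  if r = 0 then 0 else (Ring.choose ((m : ℤ) - 1) (r - 1) : ℤ) * a ^ ((m : ℤ) - r)

theorem shiftedBinomial_succ (a : ℚ) (m r : ℕ) :
    shiftedBinomial a m (r + 1) =
      (Ring.choose ((m : ℤ) - 1) r : ℤ) * a ^ ((m : ℤ) - (r + 1 : ℕ)) := by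
  rw [shiftedBinomial, if_neg r.succ_ne_zero, Nat.add_sub_cancel]

theorem shiftedBinomial_succ_mul_add {a : ℚ} (ha : a ≠ 0) (m r : ℕ) :
    shiftedBinomial a m (r + 1) * a + shiftedBinomial a m r =
      shiftedBinomial a (m + 1) (r + 1) := by
  have hpow : a ^ ((m : ℤ) - (r + 1 : ℕ)) * a = a ^ ((m : ℤ) - r) := by
    rw [← zpow_add_one₀ ha]
    congr 1
    push_cast
    ring
  have hpow' : ((m + 1 : ℕ) : ℤ) - (r + 1 : ℕ) = m - r := by push_cast; ring
  rw [shiftedBinomial_succ, shiftedBinomial_succ, hpow', mul_assoc, hpow]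
  rcases r with _ | r
  · simp [shiftedBinomial]
  · have hpascal : Ring.choose (((m + 1 : ℕ) : ℤ) - 1) (r + 1) =
        Ring.choose ((m : ℤ) - 1) r + Ring.choose ((m : ℤ) - 1) (r + 1) := by
      rw [← Ring.choose_succ_succ]
      push_cast
      ring_nf
    rw [shiftedBinomial_succ, hpascal, Int.cast_add]
    ring

theorem shiftedBinomial_zero_mul_add {a : ℚ} (ha : a ≠ 0) (r : ℕ) :
    shiftedBinomial a 0 (r + 1) * a + shiftedBinomial a 0 r = if r = 0 then 1 else 0 := by
  rw [shiftedBinomial_succ_mul_add ha, shiftedBinomial_succ, zero_add, Nat.cast_one, sub_self]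
  rcases r with _ | r <;> simp [Ring.choose_zero_succ]

variable {K : Type*} [Field K]

theorem coeff_zero_mk_shiftedBinomial_mul (a : ℚ) (x : K) (m : ℕ) (F : PowerSeries K) :
    PowerSeries.coeff 0
      ((PowerSeries.mk fun r => (shiftedBinomial a m r : K) * x ^ ((r : ℤ) - 1)) * F) = 0 := by
  simp [shiftedBinomial]

variable [CharZero K]

theorem coeff_succ_mk_shiftedBinomial_mul (a : ℚ) {x : K} (hx : x ≠ 0) (m r : ℕ) :
    PowerSeries.coeff (r + 1)
      ((PowerSeries.mk fun r => (shiftedBinomial a m r : K) * x ^ ((r : ℤ) - 1)) *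
        (PowerSeries.C (a : K) + PowerSeries.C x * PowerSeries.X)) =
      ((shiftedBinomial a m (r + 1) * a + shiftedBinomial a m r : ℚ) : K) * x ^ r := by
  have hzpow : x ^ ((r : ℤ) - 1) * x = x ^ r := by
    rw [← zpow_add_one₀ hx, sub_add_cancel, zpow_natCast]
  rw [mul_add, map_add, PowerSeries.coeff_mul_C, ← mul_assoc, PowerSeries.coeff_succ_mul_X,
    PowerSeries.coeff_mul_C, PowerSeries.coeff_mk, PowerSeries.coeff_mk, mul_assoc _ _ x, hzpow,
    Nat.cast_succ, add_sub_cancel_right, zpow_natCast]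
  push_cast
  ring

theorem mk_shiftedBinomial_mul {a : ℚ} (ha : a ≠ 0) {x : K} (hx : x ≠ 0) (m : ℕ) :
    (PowerSeries.mk fun r => (shiftedBinomial a m r : K) * x ^ ((r : ℤ) - 1)) *
        (PowerSeries.C (a : K) + PowerSeries.C x * PowerSeries.X) =
      PowerSeries.mk fun r => (shiftedBinomial a (m + 1) r : K) * x ^ ((r : ℤ) - 1) := by
  ext (_ | r)
  · rw [coeff_zero_mk_shiftedBinomial_mul]
    simp [shiftedBinomial]
  · rw [coeff_succ_mk_shiftedBinomial_mul a hx, shiftedBinomial_succ_mul_add ha,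
      PowerSeries.coeff_mk, Nat.cast_succ, add_sub_cancel_right, zpow_natCast]

theorem mk_shiftedBinomial_zero_mul {a : ℚ} (ha : a ≠ 0) {x : K} (hx : x ≠ 0) :
    (PowerSeries.mk fun r => (shiftedBinomial a 0 r : K) * x ^ ((r : ℤ) - 1)) *
        (PowerSeries.C (a : K) + PowerSeries.C x * PowerSeries.X) = PowerSeries.X := by
  ext (_ | r)
  · rw [coeff_zero_mk_shiftedBinomial_mul, PowerSeries.coeff_zero_X]
  · rw [coeff_succ_mk_shiftedBinomial_mul a hx, shiftedBinomial_zero_mul_add ha,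
      PowerSeries.coeff_X]
    rcases eq_or_ne r 0 with rfl | hr
    · simp
    · simp [hr]

theorem single_mul_C_add_single_zpow {a : ℚ} (ha : a ≠ 0) {x : K} (hx : x ≠ 0) (m : ℕ) :
    HahnSeries.single (1 : ℤ) (1 : K) *
        (HahnSeries.C (a : K) + HahnSeries.single 1 x) ^ ((m : ℤ) - 1) =
      HahnSeries.ofPowerSeries ℤ K
        (PowerSeries.mk fun r => (shiftedBinomial a m r : K) * x ^ ((r : ℤ) - 1)) := by
  have hof : (HahnSeries.C (a : K) + HahnSeries.single 1 x : LaurentSeries K) =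
      HahnSeries.ofPowerSeries ℤ K (PowerSeries.C (a : K) + PowerSeries.C x * PowerSeries.X) := by
    simp [HahnSeries.ofPowerSeries_X, HahnSeries.C_apply]
  have hne : (HahnSeries.C (a : K) + HahnSeries.single 1 x : LaurentSeries K) ≠ 0 := fun h => by
    have hcoeff := congrArg (fun f => HahnSeries.coeff f 0) h
    rw [HahnSeries.C_apply, HahnSeries.coeff_add, HahnSeries.coeff_single_same,
      HahnSeries.coeff_single_of_ne zero_ne_one, add_zero, HahnSeries.coeff_zero] at hcoeff
    exact ha (Rat.cast_eq_zero.1 hcoeff)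
  induction m with
  | zero =>
    refine mul_right_cancel₀ hne ?_
    rw [mul_assoc, ← zpow_add_one₀ hne, hof, ← map_mul, mk_shiftedBinomial_zero_mul ha hx,
      HahnSeries.ofPowerSeries_X, Nat.cast_zero, zero_sub, neg_add_cancel, zpow_zero, mul_one]
  | succ m ih =>
    rw [Nat.cast_succ, add_sub_right_comm, zpow_add_one₀ hne, ← mul_assoc, ih, hof, ← map_mul,
      mk_shiftedBinomial_mul ha hx]

variable {ι : Type*} [Fintype ι] [DecidableEq ι]

theorem coeff_zero_prod_eq_sum_shiftedBinomial {p : ι → ℚ} {x : ι → K} (hp : ∀ i, p i ≠ 0)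
    (hx : ∀ i, x i ≠ 0) {m : ι → ℕ} {N : ℕ} (hm : ∑ i, m i = N) :
    (∏ i, (HahnSeries.C (p i : K) * HahnSeries.single (-1) 1 + HahnSeries.C (x i) :
        LaurentSeries K) ^ ((m i : ℤ) - 1)).coeff 0 =
      ∑ r ∈ piAntidiag univ N, ∏ i, (shiftedBinomial (p i) (m i) (r i) : K) *
        x i ^ ((r i : ℤ) - 1) := by
  have hT : (HahnSeries.single (-1) 1 : LaurentSeries K) ≠ 0 :=
    HahnSeries.single_ne_zero one_ne_zero
  have hfactor : ∀ i, (HahnSeries.C (p i : K) * HahnSeries.single (-1) 1 + HahnSeries.C (x i) :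
      LaurentSeries K) = HahnSeries.single (-1) 1 *
        (HahnSeries.C (p i : K) + HahnSeries.single 1 (x i)) := by
    intro i
    rw [mul_add, HahnSeries.single_mul_single, neg_add_cancel, one_mul, ← HahnSeries.C_apply,
      mul_comm]
  have hpow : ∏ i, (HahnSeries.single (-1) 1 : LaurentSeries K) ^ ((m i : ℤ) - 1) =
      HahnSeries.single (-((N : ℤ) - Fintype.card ι)) 1 := by
    rw [prod_congr rfl fun i _ => zpow_sub_one₀ hT (m i : ℤ), prod_mul_distrib, prod_const]
    simp only [zpow_natCast]
    rw [prod_pow_eq_pow_sum, hm, HahnSeries.inv_single, HahnSeries.single_pow,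
      HahnSeries.single_pow, HahnSeries.single_mul_single]
    simp [sub_eq_add_neg, add_comm]
  simp only [hfactor, mul_zpow]
  rw [prod_mul_distrib, hpow, HahnSeries.coeff_single_mul, one_mul, zero_sub, neg_neg,
    coeff_prod_of_single_mul fun i => single_mul_C_add_single_zpow (hp i) (hx i) (m i)]
  simp only [PowerSeries.coeff_mk]

theorem partial_fractions {P : ι → ℕ} (hP : ∀ i, P i ≠ 0) {x : ι → K} (hx : ∀ i, x i ≠ 0)
    (hxx : ∀ i j, i ≠ j → x j - P j * x i / P i ≠ 0) {m : ι → ℕ} {N : ℕ} (hm : ∑ i, m i = N) :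
    ∑ i with m i = 0,
        (x i)⁻¹ * ∏ j ∈ univ.erase i, (x j - P j * x i / P i) ^ ((m j : ℤ) - 1) =
      ∏ i, x i ^ ((m i : ℤ) - 1) - ∑ r ∈ piAntidiag univ N,
        ∏ i, (shiftedBinomial (P i) (m i) (r i) : K) * x i ^ ((r i : ℤ) - 1) := by
  rw [← coeff_zero_prod_eq_sum_shiftedBinomial (fun i => Nat.cast_ne_zero.2 (hP i)) hx hm]
  simp only [Rat.cast_natCast]
  rw [coeff_zero_prod_linear (fun i => Nat.cast_ne_zero.2 (hP i)) hx hxx, sub_sub_cancel]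

end ShiftedBinomial

section ClearsTodd

theorem cothCoeff_of_ne_one {m : ℕ} (hm : m ≠ 1) :
    cothCoeff m = bernoulli m / (m.factorial : ℚ) := by
  simp [cothCoeff, periodicBernoulli, hm]

theorem cothCoeff_one : cothCoeff 1 = 0 := by
  simp [cothCoeff, periodicBernoulli]

theorem exists_cothCoeff_eq_int_mul (m : ℕ) :
    ∃ s : ℤ, cothCoeff m = s * PowerSeries.coeff m toddSeries := by
  rcases eq_or_ne m 1 with rfl | hm
  · exact ⟨0, by rw [cothCoeff_one, Int.cast_zero, zero_mul]⟩
  · refine ⟨(-1) ^ m, ?_⟩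
    rw [cothCoeff_of_ne_one hm, toddSeries, PowerSeries.coeff_mk]
    push_cast
    rw [mul_left_comm, ← mul_pow]
    simp

theorem exists_ite_eq_int_mul (m : ℕ) :
    ∃ s : ℤ, (if m = 1 then 1 / 2 else 0 : ℚ) = s * PowerSeries.coeff m toddSeries := by
  rcases eq_or_ne m 1 with rfl | hm
  · exact ⟨1, by norm_num [toddSeries, bernoulli_one]⟩
  · exact ⟨0, by simp [hm]⟩

variable {ι : Type*} [Fintype ι]

/-- Multiplication by `c` clears the denominators of the coefficients of total degree `N` of the
product of the Todd series in variables indexed by `ι`. -/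
def ClearsTodd (ι : Type*) [Fintype ι] (N : ℕ) (c : ℚ) : Prop :=
  ∀ m : ι → ℕ, ∑ i, m i = N → ∃ a : ℤ, c * ∏ i, PowerSeries.coeff (m i) toddSeries = a

variable {N : ℕ} {c : ℚ}

theorem ClearsTodd.clearsCoth (hc : ClearsTodd ι N c) {K : Type*} [Field K] [CharZero K]
    (O : Subring K) : ClearsCoth O ι N (c : K) := by
  intro m hm t ht
  obtain ⟨a, ha⟩ := hc m hm
  have hmul : ∀ i, ∃ s : ℤ, t i = ((s * PowerSeries.coeff (m i) toddSeries : ℚ) : K) := by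
    intro i
    rcases ht i with h | h
    · exact (exists_cothCoeff_eq_int_mul (m i)).imp fun s hs => by rw [h, hs]
    · exact (exists_ite_eq_int_mul (m i)).imp fun s hs => by
        rw [h, ← hs]
        split_ifs <;> norm_num
  choose s hs using hmul
  have hprod : c * ∏ i, (s i * PowerSeries.coeff (m i) toddSeries) = ((∏ i, s i) * a : ℤ) := by
    rw [Finset.prod_mul_distrib, mul_left_comm, ha]
    push_cast
    rfl
  simp only [hs]
  rw [← Rat.cast_prod, ← Rat.cast_mul, hprod, Rat.cast_intCast]
  exact intCast_mem _ _

theorem ClearsTodd.exists_int_cothCoeff (hc : ClearsTodd ι N c) {m : ι → ℕ} (hm : ∑ i, m i = N) :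
    ∃ a : ℤ, c * ∏ i, cothCoeff (m i) = a := by
  obtain ⟨a, ha⟩ := hc.clearsCoth (Int.castRingHom ℚ).range m hm (fun i => cothCoeff (m i))
    fun i => Or.inl (Rat.cast_id _).symm
  exact ⟨a, ha.symm⟩

end ClearsTodd

section PrimeToModulus

open MvPolynomial in
theorem exists_isAlgClosed_algebraicIndependent.{u} (ι : Type u) :
    ∃ (K : Type u) (_ : Field K) (_ : CharZero K) (_ : IsAlgClosed K) (x : ι → K),
      AlgebraicIndependent ℚ x := by
  let F := FractionRing (MvPolynomial ι ℚ)
  have : CharZero (AlgebraicClosure F) := algebraRat.charZero _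
  have hinj : Function.Injective (algebraMap (MvPolynomial ι ℚ) (AlgebraicClosure F)) := by
    rw [IsScalarTower.algebraMap_eq _ F]
    exact (algebraMap F _).injective.comp (FaithfulSMul.algebraMap_injective _ F)
  have hX : AlgebraicIndependent ℚ
      fun i => algebraMap (MvPolynomial ι ℚ) (AlgebraicClosure F) (X i) := by
    convert (algebraicIndependent_X ι ℚ).map'
      (f := IsScalarTower.toAlgHom ℚ (MvPolynomial ι ℚ) (AlgebraicClosure F)) hinj
    rfl
  exact ⟨AlgebraicClosure F, inferInstance, this, inferInstance, _, hX⟩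

variable {ι : Type*} [Fintype ι] [DecidableEq ι] {N : ℕ}

section

variable {K : Type*} [Field K] [CharZero K] {ℓ : ℕ} {hℓ : ℓ.Prime} {x : ι → K}

open MvPolynomial in
theorem coeff_mem_of_sum_mem_gaussSubring (hx : AlgebraicIndependent ℚ x)
    (v : (ι → ℕ) → ℚ) (h : ∑ r ∈ Finset.piAntidiag Finset.univ N,
      (v r : K) * ∏ i, x i ^ ((r i : ℤ) - 1) ∈ gaussSubring hℓ x) {r : ι → ℕ}
    (hr : ∑ i, r i = N) : v r ∈ rationalsAt hℓ := by
  have hunit := (unimodular_gaussSubring (hℓ := hℓ) hx).isUnitIn hℓ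
  set g : MvPolynomial ι ℚ := ∑ r ∈ Finset.piAntidiag Finset.univ N,
    monomial (Finsupp.equivFunOnFinite.symm r) (v r) with hg
  have haeval : aeval x g = (∑ r ∈ Finset.piAntidiag Finset.univ N,
      (v r : K) * ∏ i, x i ^ ((r i : ℤ) - 1)) * ∏ i, x i := by
    rw [hg, map_sum, Finset.sum_mul]
    refine Finset.sum_congr rfl fun r _ => ?_
    rw [aeval_monomial, mul_assoc, ← Finset.prod_mul_distrib, Finsupp.prod_fintype _ _ (by simp)]
    congr 1
    refine Finset.prod_congr rfl fun i _ => ?_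
    rw [zpow_sub_one₀ (hunit i).1, zpow_natCast, inv_mul_cancel_right₀ (hunit i).1]
    rfl
  have hcoeff : g.coeff (Finsupp.equivFunOnFinite.symm r) = v r := by
    rw [hg, coeff_sum, Finset.sum_eq_single r, coeff_monomial, if_pos rfl]
    · intro b _ hb
      exact (coeff_monomial _ _ _).trans
        (if_neg fun he => hb (Finsupp.equivFunOnFinite.symm.injective he))
    · intro hn
      exact absurd (Finset.mem_piAntidiag.2 ⟨hr, fun i _ => Finset.mem_univ i⟩) hn
  rw [← hcoeff]
  refine coeff_mem_of_aeval_mem_gaussSubring hx ?_ _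
  rw [haeval]
  exact mul_mem h (prod_mem fun i _ => (hunit i).2.1)

end

theorem mul_dedekindCoeff_mem_rationalsAt {ℓ : ℕ} (hℓ : ℓ.Prime) {c : ℚ}
    (hc : ClearsTodd ι N c) {Q : ℕ} (hQ : ¬ ℓ ∣ Q) (P : ι → ℕ) {r : ι → ℕ}
    (hr : ∑ i, r i = N) : c * dedekindCoeff Q P r ∈ rationalsAt hℓ := by
  obtain ⟨K, _, _, _, x, hx⟩ := exists_isAlgClosed_algebraicIndependent ι
  have hQ0 : Q ≠ 0 := fun h => hQ (h ▸ dvd_zero _)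
  have hunimod := unimodular_gaussSubring (hℓ := hℓ) hx
  have h := cothSum_mem_integralAt hℓ (fun m hm => isUnitIn_gaussSubring_natCast hx hm)
    (hc.clearsCoth (gaussSubring hℓ x)) hQ P hunimod
  rw [mem_integralAt, coeff_cothSum hQ0 P fun i => (hunimod.isUnitIn hℓ i).1, Finset.mul_sum] at h
  refine coeff_mem_of_sum_mem_gaussSubring hx (fun r => c * dedekindCoeff Q P r) ?_ hr
  simpa only [Rat.cast_mul, mul_assoc] using h

end PrimeToModulus

section VanishingIndex

variable {K : Type*} [Field K] [CharZero K] {Q : ℕ}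

theorem bernoulliFourier_one (hQ : Q ≠ 0) (r : ℕ) :
    bernoulliFourier Q r (1 : K) = cothCoeff r := by
  have hmod := single_mul_cothFun hQ (one_pow Q : (1 : K) ^ Q = 1) (one_ne_zero (α := K))
  rw [(map_one _ : (HahnSeries.C (1 : K) : LaurentSeries K) = 1), one_mul,
    single_mul_cothFun_expLaurent one_ne_zero] at hmod
  simpa using (congrArg (PowerSeries.coeff r) (HahnSeries.ofPowerSeries_injective hmod)).symm

theorem bernoulliFourier_zero {w : K} (hw : w ^ Q = 1) (hw1 : w ≠ 1) :
    bernoulliFourier Q 0 w = 0 := by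
  have hgeom : ∑ k ∈ Finset.range Q, w ^ k = 0 := by
    rw [geom_sum_eq hw1, hw, sub_self, zero_div]
  have hmul : bernoulliFourier Q 0 w = (∑ k ∈ Finset.range Q, w ^ k) * (Q : K)⁻¹ := by
    rw [bernoulliFourier, Finset.sum_mul]
    simp [bernoulliWeight, periodicBernoulli]
  rw [hmul, hgeom, zero_mul]

variable {ι : Type*} [Fintype ι] [DecidableEq ι]

theorem dedekindCoeff_of_eq_zero (hQ : Q ≠ 0) {P r : ι → ℕ} {i : ι} (hi : r i = 0)
    (hP : Nat.Coprime (P i) Q) : dedekindCoeff Q P r = ∏ i, cothCoeff (r i) := by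
  have hsum := sum_prod_bernoulliFourier (K := AlgebraicClosure ℚ) hQ P r
  rw [Finset.sum_eq_single 1] at hsum
  · simp only [one_pow, bernoulliFourier_one hQ] at hsum
    exact_mod_cast hsum.symm
  · intro w hw hw1
    rw [Polynomial.mem_nthRootsFinset (Nat.pos_of_ne_zero hQ)] at hw
    refine Finset.prod_eq_zero (Finset.mem_univ i) ?_
    rw [hi]
    refine bernoulliFourier_zero (by rw [pow_right_comm, hw, one_pow]) fun hPi => hw1 ?_
    simpa [hP.gcd_eq_one] using pow_gcd_eq_one.2 ⟨hPi, hw⟩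
  · intro hone
    exact absurd (Polynomial.one_mem_nthRootsFinset (Nat.pos_of_ne_zero hQ)) hone

end VanishingIndex

section PrimeDividingModulus

open Finset

variable {ι : Type*} [Fintype ι] [DecidableEq ι]

/-- The weighted sum of `∏ i, cothCoeff (m i)` over the indices `m` of degree `N` with a zero
coordinate. With `weight i m = shiftedBinomial (P i) m (r i)` it is, modulo `q`, the negative of the
normalized Dedekind sum `dedekindCoeff q P r`. -/
noncomputable def correctionSum (N : ℕ) (weight : ι → ℕ → ℚ) : ℚ :=
  ∑ m ∈ piAntidiag univ N with ∃ i, m i = 0, ∏ i, cothCoeff (m i) * weight i (m i)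

variable {K : Type*} [Field K]

/-- For `m i = 0`, the negative of the residue of `∏ j, (P j * T + x j) ^ (m j - 1) * dT / T` at
`T = -x i / P i`. -/
noncomputable def linearResidue (P : ι → ℕ) (x : ι → K) (m : ι → ℕ) (i : ι) : K :=
  (x i)⁻¹ * ∏ j ∈ univ.erase i, (x j - P j * x i / P i) ^ ((m j : ℤ) - 1)

theorem prod_reciprocalForms_zpow (q : ℕ) (P : ι → ℕ) (x : ι → K) (i : ι) (e : ι → ℤ) :
    ∏ j, reciprocalForms q P x i j ^ e j =
      (-(q * x i / P i)) ^ e i * ∏ j ∈ univ.erase i, (x j - P j * x i / P i) ^ e j := by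
  rw [← mul_prod_erase _ _ (mem_univ i), reciprocalForms, Function.update_self]
  congr 1
  exact prod_congr rfl fun j hj => by rw [Function.update_of_ne (ne_of_mem_erase hj)]

variable [CharZero K] {q N : ℕ} {P r : ι → ℕ} {x : ι → K} {i : ι}

/-- The contribution of the index `r` to the `i`-th term of the reciprocity law. -/
noncomputable def reciprocalTerm (q : ℕ) (P : ι → ℕ) (x : ι → K) (r : ι → ℕ) (i : ι) : K :=
  (P i : K)⁻¹ * ((dedekindCoeff (P i) (Function.update P i q) r : K) *
    ∏ j, reciprocalForms q P x i j ^ ((r j : ℤ) - 1))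

theorem reciprocalTerm_of_eq_zero (hPi : P i ≠ 0) (hq : Nat.Coprime q (P i)) (hi : r i = 0) :
    reciprocalTerm q P x r i = -((∏ j, cothCoeff (r j) : ℚ) * linearResidue P x r i) / q := by
  have hPK : (P i : K) ≠ 0 := Nat.cast_ne_zero.2 hPi
  rw [reciprocalTerm, prod_reciprocalForms_zpow, linearResidue,
    dedekindCoeff_of_eq_zero hPi hi (by rwa [Function.update_self]), hi, Nat.cast_zero, zero_sub,
    zpow_neg_one, inv_neg, inv_div]
  field_simp

theorem sum_dedekindCoeff_add_sum_reciprocalTerm [IsAlgClosed K] (hq : q ≠ 0)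
    (hP : ∀ i, P i ≠ 0) (hx : ∀ i, x i ≠ 0) (hxx : ∀ i j, i ≠ j → x j - P j * x i / P i ≠ 0)
    (N : ℕ) :
    (q : K)⁻¹ * ∑ r ∈ piAntidiag univ N, (dedekindCoeff q P r : K) * ∏ i, x i ^ ((r i : ℤ) - 1) +
        ∑ i, ∑ r ∈ piAntidiag univ N, reciprocalTerm q P x r i =
      (cothBoundary P x).coeff ((N : ℤ) - Fintype.card ι) := by
  have hforms : ∀ i j, reciprocalForms q P x i j ≠ 0 := by
    intro i j
    rw [reciprocalForms]
    rcases eq_or_ne j i with rfl | hij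
    · rw [Function.update_self]
      exact neg_ne_zero.2 (div_ne_zero (mul_ne_zero (Nat.cast_ne_zero.2 hq) (hx j))
        (Nat.cast_ne_zero.2 (hP j)))
    · rw [Function.update_of_ne hij]
      exact hxx i j hij.symm
  have hC (m : ℕ) : (m : LaurentSeries K)⁻¹ = HahnSeries.C (m : K)⁻¹ := by
    rw [map_inv₀, map_natCast]
  rw [← cothSum_reciprocity hq hx fun i j hij _ => hxx i j hij]
  simp only [hC, HahnSeries.C_mul_eq_smul, HahnSeries.coeff_add, HahnSeries.coeff_sum,
    HahnSeries.coeff_smul, smul_eq_mul, coeff_cothSum hq P hx, coeff_cothSum (hP _) _ (hforms _),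
    reciprocalTerm, mul_sum]

theorem sum_linearResidue (hP : ∀ i, P i ≠ 0) (hx : ∀ i, x i ≠ 0)
    (hxx : ∀ i j, i ≠ j → x j - P j * x i / P i ≠ 0) (N : ℕ) (b : (ι → ℕ) → K) :
    ∑ i, ∑ m ∈ piAntidiag univ N with m i = 0, b m * linearResidue P x m i =
      ∑ m ∈ piAntidiag univ N with ∃ i, m i = 0, b m * (∏ i, x i ^ ((m i : ℤ) - 1) -
        ∑ r ∈ piAntidiag univ N,
          ∏ i, (shiftedBinomial (P i) (m i) (r i) : K) * x i ^ ((r i : ℤ) - 1)) := by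
  rw [sum_comm' (t' := {m ∈ piAntidiag univ N | ∃ i, m i = 0})
    (s' := fun m => {i | m i = 0}) fun i m => by simp only [mem_filter]; grind]
  refine sum_congr rfl fun m hm => ?_
  have hsum := (mem_piAntidiag.1 (mem_filter.1 hm).1).1
  rw [← mul_sum, ← partial_fractions hP hx hxx hsum]
  rfl

section

variable {ℓ : ℕ} {hℓ : ℓ.Prime} {c : ℚ}

theorem mul_reciprocalTerm_mem_gaussSubring (hx : AlgebraicIndependent ℚ x)
    (hc : ClearsTodd ι N c) (hPi : ¬ ℓ ∣ P i)
    (hxx : ∀ j, i ≠ j → IsUnitIn (gaussSubring hℓ x) (x j - P j * x i / P i))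
    (hr : ∑ i, r i = N) (hri : r i ≠ 0) :
    c * reciprocalTerm q P x r i ∈ gaussSubring hℓ x := by
  have hPinv := (isUnitIn_gaussSubring_natCast (hℓ := hℓ) hx hPi).2.2
  have hxi := ((unimodular_gaussSubring (hℓ := hℓ) hx).isUnitIn hℓ i).2.1
  have hcoeff : (c * dedekindCoeff (P i) (Function.update P i q) r : K) ∈ gaussSubring hℓ x := by
    exact_mod_cast ratCast_mem_gaussSubring hx (mul_dedekindCoeff_mem_rationalsAt hℓ hc hPi _ hr)
  rw [reciprocalTerm, mul_left_comm, ← mul_assoc (c : K), prod_reciprocalForms_zpow]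
  refine mul_mem hPinv (mul_mem hcoeff (mul_mem ?_ (prod_mem fun j hj =>
    (hxx j (ne_of_mem_erase hj).symm).zpow_mem _)))
  rw [← Nat.cast_one, ← Nat.cast_sub (Nat.one_le_iff_ne_zero.2 hri), zpow_natCast, div_eq_mul_inv]
  exact pow_mem (neg_mem (mul_mem (mul_mem (natCast_mem _ _) hxi) hPinv)) _

/-- Modulo `q`, only the indices with a zero coordinate contribute to the reciprocity law. -/
theorem mul_sum_dedekindCoeff_sub_sum_linearResidue_mem [IsAlgClosed K]
    (hx : AlgebraicIndependent ℚ x) (hc : ClearsTodd ι N c) (hq : q ≠ 0) (hℓP : ∀ i, ¬ ℓ ∣ P i)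
    (hP : ∀ i, Nat.Coprime q (P i)) :
    c * (∑ r ∈ piAntidiag univ N, (dedekindCoeff q P r : K) * ∏ i, x i ^ ((r i : ℤ) - 1) -
        ∑ i, ∑ m ∈ piAntidiag univ N with m i = 0,
          (∏ j, cothCoeff (m j) : ℚ) * linearResidue P x m i) / q ∈ gaussSubring hℓ x := by
  have hunimod := unimodular_gaussSubring (hℓ := hℓ) hx
  have hP0 : ∀ i, P i ≠ 0 := fun i h => hℓP i (h ▸ dvd_zero _)
  have hxx : ∀ i j, i ≠ j → IsUnitIn (gaussSubring hℓ x) (x j - P j * x i / P i) := fun i j hij =>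
    hunimod.isUnitIn_sub_mul_div hℓ (fun m hm => isUnitIn_gaussSubring_natCast hx hm) hij (hℓP i)
  have hrec := sum_dedekindCoeff_add_sum_reciprocalTerm hq hP0
    (fun i => (hunimod.isUnitIn hℓ i).1) (fun i j hij => (hxx i j hij).1) N
  have hsplit (i : ι) : ∑ r ∈ piAntidiag univ N, reciprocalTerm q P x r i =
      -(∑ m ∈ piAntidiag univ N with m i = 0,
          (∏ j, cothCoeff (m j) : ℚ) * linearResidue P x m i) / q +
        ∑ r ∈ piAntidiag univ N with r i ≠ 0, reciprocalTerm q P x r i := by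
    rw [← sum_filter_add_sum_filter_not _ fun r => r i = 0, ← sum_neg_distrib, sum_div]
    congr 1
    exact sum_congr rfl fun r hr => reciprocalTerm_of_eq_zero (hP0 i) (hP i) (mem_filter.1 hr).2
  simp only [hsplit, sum_add_distrib, ← sum_div, sum_neg_distrib] at hrec
  have hboundary := cothBoundary_mem_integralAt (hc.clearsCoth (gaussSubring hℓ x)) P
    (hunimod.isUnitIn hℓ)
  rw [mem_integralAt, ← hrec] at hboundary
  have hrest : ∑ i, ∑ r ∈ piAntidiag univ N with r i ≠ 0, c * reciprocalTerm q P x r i ∈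
      gaussSubring hℓ x := sum_mem fun i _ => sum_mem fun r hr =>
    mul_reciprocalTerm_mem_gaussSubring hx hc (hℓP i) (hxx i)
      (mem_piAntidiag.1 (mem_filter.1 hr).1).1 (mem_filter.1 hr).2
  convert sub_mem hboundary hrest using 1
  simp only [← mul_sum]
  ring

end

theorem mul_dedekindCoeff_add_correctionSum_div_mem_rationalsAt {ℓ : ℕ} (hℓ : ℓ.Prime) {c : ℚ}
    (hc : ClearsTodd ι N c) (hq : q ≠ 0) (hℓq : ℓ ∣ q) (hP : ∀ i, Nat.Coprime q (P i))
    (hr : ∑ i, r i = N) (hr0 : ∀ i, r i ≠ 0) :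
    c * (dedekindCoeff q P r + correctionSum N fun i m => shiftedBinomial (P i) m (r i)) / q ∈
      rationalsAt hℓ := by
  obtain ⟨K, _, _, _, x, hx⟩ := exists_isAlgClosed_algebraicIndependent ι
  have hℓP (i : ι) : ¬ ℓ ∣ P i := fun h => Nat.not_coprime_of_dvd_of_dvd hℓ.one_lt hℓq h (hP i)
  have hP0 (i : ι) : P i ≠ 0 := fun h => hℓP i (h ▸ dvd_zero _)
  have hunimod := unimodular_gaussSubring (hℓ := hℓ) hx
  set b : (ι → ℕ) → ℚ := fun m => ∏ i, cothCoeff (m i) with hb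
  set v : (ι → ℕ) → ℚ := fun r => c * (dedekindCoeff q P r -
    (if ∃ i, r i = 0 then b r else 0) +
      correctionSum N fun i m => shiftedBinomial (P i) m (r i)) / q with hv
  have hvr : v r = c * (dedekindCoeff q P r +
      correctionSum N fun i m => shiftedBinomial (P i) m (r i)) / q := by
    simp [hv, hr0]
  rw [← hvr]
  refine coeff_mem_of_sum_mem_gaussSubring hx v ?_ hr
  have hmem := mul_sum_dedekindCoeff_sub_sum_linearResidue_mem (hℓ := hℓ) (N := N) hx hc hq hℓP hP
  rw [sum_linearResidue hP0 (fun i => (hunimod.isUnitIn hℓ i).1) fun i j hij =>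
    (hunimod.isUnitIn_sub_mul_div hℓ (fun m hm => isUnitIn_gaussSubring_natCast hx hm) hij
      (hℓP i)).1] at hmem
  convert hmem using 1
  have hterm (r : ι → ℕ) : (v r : K) * ∏ i, x i ^ ((r i : ℤ) - 1) =
      c * ((dedekindCoeff q P r : K) * ∏ i, x i ^ ((r i : ℤ) - 1) -
        (if ∃ i, r i = 0 then (b r : K) * ∏ i, x i ^ ((r i : ℤ) - 1) else 0) +
        ∑ m ∈ piAntidiag univ N with ∃ i, m i = 0, (b m : K) *
          ∏ i, (shiftedBinomial (P i) (m i) (r i) : K) * x i ^ ((r i : ℤ) - 1)) / q := by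
    simp only [hv, hb, correctionSum, prod_mul_distrib, ← mul_assoc, ← sum_mul]
    split_ifs <;> push_cast <;> ring
  rw [sum_congr rfl fun r _ => hterm r, ← sum_div, ← mul_sum, sum_add_distrib, sum_sub_distrib,
    ← sum_filter, sum_comm]
  simp only [mul_sub, sum_sub_distrib, ← mul_sum]
  ring

end PrimeDividingModulus

section ToddDenominator

theorem coeff_toddPolynomial {n N : ℕ} {m : Fin n → ℕ} (hm : ∑ i, m i = N) :
    (toddPolynomial n N).coeff (Finsupp.equivFunOnFinite.symm m) =
      ∏ i, PowerSeries.coeff (m i) toddSeries := by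
  rw [toddPolynomial, MvPolynomial.coeff_sum, Finset.sum_eq_single m, MvPolynomial.coeff_monomial,
    if_pos rfl]
  · intro b _ hb
    exact (MvPolynomial.coeff_monomial _ _ _).trans
      (if_neg fun he => hb (Finsupp.equivFunOnFinite.symm.injective he))
  · intro hn
    exact absurd (Finset.mem_piAntidiag.2 ⟨hm, fun i _ => Finset.mem_univ i⟩) hn

theorem clearsTodd_toddDenominator (N n : ℕ) :
    ClearsTodd (Fin n) N (toddDenominator N n : ℚ) := by
  intro m hm
  rw [← coeff_toddPolynomial hm]
  set y := (toddPolynomial n N).coeff (Finsupp.equivFunOnFinite.symm m)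
  rcases eq_or_ne y 0 with h0 | h0
  · exact ⟨0, by rw [h0, mul_zero, Int.cast_zero]⟩
  · obtain ⟨e, he⟩ : y.den ∣ toddDenominator N n :=
      Finset.dvd_lcm (f := fun m => ((toddPolynomial n N).coeff m).den)
        (MvPolynomial.mem_support_iff.2 h0)
    refine ⟨e * y.num, ?_⟩
    rw [he]
    push_cast
    rw [← Rat.mul_den_eq_num]
    ring

end ToddDenominator

section GeneralizedDedekindSum

theorem periodicBernoulli_add_intCast (k : ℕ) (t : ℚ) (z : ℤ) :
    periodicBernoulli k (t + z) = periodicBernoulli k t := by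
  simp only [periodicBernoulli, Int.fract_add_intCast]

theorem periodicBernoulli_emod_div {q : ℕ} (hq : q ≠ 0) (k : ℕ) (s : ℤ) :
    periodicBernoulli k (((s % q : ℤ) : ℚ) / q) = periodicBernoulli k (s / q) := by
  have hq' : (q : ℚ) ≠ 0 := Nat.cast_ne_zero.2 hq
  rw [← periodicBernoulli_add_intCast k _ (s / q)]
  congr 1
  rw [div_add' _ _ _ hq']
  exact_mod_cast congrArg (fun z : ℤ => (z : ℚ) / q) (Int.emod_add_ediv_mul s q)

theorem mul_prod_bernoulliWeight {ι : Type*} [Fintype ι] {Q : ℕ} {r : ι → ℕ} (hr : ∀ i, r i ≠ 0)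
    (k : ι → ℕ) :
    (Q : ℚ) * ∏ i, bernoulliWeight Q (r i) (k i) =
      (Q : ℚ) ^ (∑ i, r i + 1 - Fintype.card ι) * (∏ i, periodicBernoulli (r i) (k i / Q)) /
        ∏ i, ((r i).factorial : ℚ) := by
  have hexp : ∑ i, r i + 1 - Fintype.card ι = ∑ i, (r i - 1) + 1 := by
    have hsum : ∑ i, r i = ∑ i, (r i - 1) + Fintype.card ι := by
      rw [← Finset.sum_congr rfl fun i _ => Nat.succ_pred (hr i)]
      simp [Finset.sum_add_distrib]
    omega
  have hpow (i : ι) : (Q : ℚ) ^ ((r i : ℤ) - 1) = (Q : ℚ) ^ (r i - 1) := by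
    rw [← Nat.cast_one, ← Nat.cast_sub (Nat.one_le_iff_ne_zero.2 (hr i)), zpow_natCast]
  simp only [bernoulliWeight, hpow, Finset.prod_mul_distrib, Finset.prod_div_distrib,
    Finset.prod_pow_eq_pow_sum, hexp, pow_succ]
  ring

variable {n q : ℕ} {p : Fin n → ℤ} {P : Fin (n + 1) → ℕ}

theorem dvd_sum_mul_snoc_iff
    (hP : ∀ i, (P i : ℤ) ≡ (Fin.snoc p (-1) : Fin (n + 1) → ℤ) i [ZMOD q]) (k : Fin n → Fin q)
    (a : Fin q) :
    q ∣ ∑ i, P i * ((Fin.snoc k a : Fin (n + 1) → Fin q) i : ℕ) ↔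
      ((a : ℕ) : ℤ) = (∑ i, p i * (k i : ℕ)) % q := by
  have hmod : ((∑ i, P i * ((Fin.snoc k a : Fin (n + 1) → Fin q) i : ℕ) : ℕ) : ℤ) ≡
      ∑ i, p i * (k i : ℕ) - (a : ℕ) [ZMOD q] := by
    have hsnoc := Int.ModEq.sum (s := Finset.univ) fun i _ =>
      (hP i).mul_right ((Fin.snoc k a : Fin (n + 1) → Fin q) i : ℕ)
    rw [Fin.sum_univ_castSucc, Fin.sum_univ_castSucc] at hsnoc
    simpa [Fin.sum_univ_castSucc, ← sub_eq_add_neg] using hsnoc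
  have ha : ((a : ℕ) : ℤ) % q = (a : ℕ) :=
    Int.emod_eq_of_lt (Int.natCast_nonneg _) (Int.ofNat_lt.2 a.2)
  rw [← Int.natCast_dvd_natCast, hmod.dvd_iff, ← Int.modEq_iff_dvd, Int.ModEq, ha]

theorem sum_snoc_eq_generalizedDedekindSum (hq : q ≠ 0)
    (hP : ∀ i, (P i : ℤ) ≡ (Fin.snoc p (-1) : Fin (n + 1) → ℤ) i [ZMOD q])
    (r : Fin (n + 1) → ℕ) :
    (∑ k : Fin (n + 1) → Fin q, if q ∣ ∑ i, P i * (k i : ℕ) then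
      ∏ i, periodicBernoulli (r i) ((k i : ℕ) / q) else 0) = generalizedDedekindSum r q p := by
  have hqZ : (q : ℤ) ≠ 0 := Nat.cast_ne_zero.2 hq
  rw [← Equiv.sum_comp (Fin.snocEquiv fun _ => Fin q), Fintype.sum_prod_type_right,
    generalizedDedekindSum]
  refine Finset.sum_congr rfl fun k _ => ?_
  simp only [Fin.snocEquiv_apply, dvd_sum_mul_snoc_iff hP]
  set s : ℤ := ∑ i, p i * (k i : ℕ) with hs
  have hlast : ((s % q).toNat : ℤ) = s % q := Int.toNat_of_nonneg (Int.emod_nonneg s hqZ)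
  have hlt : (s % q).toNat < q := by
    have := Int.emod_lt_of_pos s (by omega : (0 : ℤ) < q)
    omega
  rw [Finset.sum_eq_single (⟨(s % q).toNat, hlt⟩ : Fin q), if_pos hlast, Fin.prod_univ_castSucc]
  · simp only [Fin.snoc_castSucc, Fin.snoc_last]
    congr 1
    rw [← Int.cast_natCast, hlast, periodicBernoulli_emod_div hq, hs]
    push_cast
    rfl
  · intro a _ ha
    exact if_neg fun h => ha (Fin.ext (Int.ofNat_inj.1 (h.trans hlast.symm)))
  · intro h
    exact absurd (Finset.mem_univ _) h

theorem dedekindCoeff_eq_generalizedDedekindSum (hq : q ≠ 0)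
    (hP : ∀ i, (P i : ℤ) ≡ (Fin.snoc p (-1) : Fin (n + 1) → ℤ) i [ZMOD q])
    {r : Fin (n + 1) → ℕ} (hr : ∀ i, r i ≠ 0) :
    dedekindCoeff q P r = (q : ℚ) ^ (∑ i, r i - n) * generalizedDedekindSum r q p /
      ∏ i, ((r i).factorial : ℚ) := by
  rw [dedekindCoeff, ← sum_snoc_eq_generalizedDedekindSum hq hP r, Finset.mul_sum, Finset.mul_sum,
    Finset.sum_div]
  refine Finset.sum_congr rfl fun k _ => ?_
  split_ifs
  · rw [mul_prod_bernoulliWeight hr, Fintype.card_fin, Nat.add_sub_add_right]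
  · rw [mul_zero, mul_zero, zero_div]

end GeneralizedDedekindSum

section CorrectionSum

theorem prod_sub_prod_div_mem {ι K : Type*} [Field K] (O : Subring K)
    (s : Finset ι) (q : K) {x y : ι → K} (hx : ∀ i, x i ∈ O) (hy : ∀ i, y i ∈ O)
    (h : ∀ i, (x i - y i) / q ∈ O) :
    (∏ i ∈ s, x i - ∏ i ∈ s, y i) / q ∈ O := by
  classical
  induction s using Finset.induction_on with
  | empty => simp
  | insert a s ha ih =>
    rw [Finset.prod_insert ha, Finset.prod_insert ha]
    have htelescope : (x a * ∏ i ∈ s, x i - y a * ∏ i ∈ s, y i) / q =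
        (x a - y a) / q * ∏ i ∈ s, x i + y a * ((∏ i ∈ s, x i - ∏ i ∈ s, y i) / q) := by ring
    rw [htelescope]
    exact add_mem (mul_mem (h a) (prod_mem fun i _ => hx i)) (mul_mem (hy a) ih)

variable {ι : Type*} [Fintype ι] [DecidableEq ι] {N : ℕ} {c : ℚ} {β γ : ι → ℕ → ℚ}

theorem mul_correctionSum (c : ℚ) (N : ℕ) (β : ι → ℕ → ℚ) :
    c * correctionSum N β = ∑ m ∈ Finset.piAntidiag Finset.univ N with ∃ i, m i = 0,
      (c * ∏ i, cothCoeff (m i)) * ∏ i, β i (m i) := by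
  simp only [correctionSum, Finset.mul_sum, Finset.prod_mul_distrib, mul_assoc]

theorem ClearsTodd.mul_prod_cothCoeff_mem (hc : ClearsTodd ι N c) (O : Subring ℚ) {m : ι → ℕ}
    (hm : m ∈ Finset.piAntidiag Finset.univ N) : c * ∏ i, cothCoeff (m i) ∈ O := by
  obtain ⟨z, hz⟩ := hc.exists_int_cothCoeff (Finset.mem_piAntidiag.1 hm).1
  exact hz ▸ intCast_mem O z

theorem ClearsTodd.mul_correctionSum_mem (hc : ClearsTodd ι N c) {O : Subring ℚ}
    (hβ : ∀ i m, β i m ∈ O) : c * correctionSum N β ∈ O := by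
  rw [mul_correctionSum]
  exact sum_mem fun m hm => mul_mem (hc.mul_prod_cothCoeff_mem O (Finset.mem_filter.1 hm).1)
    (prod_mem fun i _ => hβ i (m i))

theorem ClearsTodd.mul_correctionSum_sub_div_mem (hc : ClearsTodd ι N c) {O : Subring ℚ} {q : ℚ}
    (hβ : ∀ i m, β i m ∈ O) (hγ : ∀ i m, γ i m ∈ O) (h : ∀ i m, (β i m - γ i m) / q ∈ O) :
    c * (correctionSum N β - correctionSum N γ) / q ∈ O := by
  rw [mul_sub, mul_correctionSum, mul_correctionSum, ← Finset.sum_sub_distrib, Finset.sum_div]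
  refine sum_mem fun m hm => ?_
  rw [← mul_sub, mul_div_assoc]
  exact mul_mem (hc.mul_prod_cothCoeff_mem O (Finset.mem_filter.1 hm).1)
    (prod_sub_prod_div_mem O _ q (fun i => hβ i (m i)) (fun i => hγ i (m i)) fun i => h i (m i))

theorem cothCoeff_eq_zero_of_odd {m : ℕ} (hm : Odd m) : cothCoeff m = 0 := by
  rcases eq_or_ne m 1 with rfl | h1
  · exact cothCoeff_one
  · rw [cothCoeff_of_ne_one h1, bernoulli_eq_zero_of_odd hm (by grind), zero_div]

theorem cothCoeff_of_even {m : ℕ} (hm : Even m) : cothCoeff m = bernoulli m / m.factorial :=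
  cothCoeff_of_ne_one fun h1 => Nat.not_even_one (h1 ▸ hm)

theorem correctionSum_eq_sum_evenIndices {n : ℕ} (β : Fin n → ℕ → ℚ) :
    correctionSum N β = ∑ m ∈ evenIndices n N,
      (∏ i, bernoulli (m i) / ((m i).factorial : ℚ)) * ∏ i, β i (m i) := by
  rw [correctionSum]
  symm
  refine Finset.sum_subset_zero_on_sdiff (fun m hm => ?_) (fun m hm => ?_) fun m hm => ?_
  · simp only [evenIndices, Finset.mem_filter] at hm ⊢
    exact ⟨hm.1, hm.2.2⟩
  · simp only [Finset.mem_sdiff, evenIndices, Finset.mem_filter] at hm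
    obtain ⟨i, hi⟩ : ∃ i, Odd (m i) := by
      by_contra! h
      exact hm.2 ⟨hm.1.1, fun i => Nat.not_odd_iff_even.1 (h i), hm.1.2⟩
    exact Finset.prod_eq_zero (Finset.mem_univ i) (by rw [cothCoeff_eq_zero_of_odd hi, zero_mul])
  · rw [← Finset.prod_mul_distrib]
    exact Finset.prod_congr rfl fun i _ =>
      by rw [cothCoeff_of_even ((Finset.mem_filter.1 hm).2.1 i)]

end CorrectionSum

section Congruence

/-- The integer that replaces `shiftedBinomial P m r` modulo `q`, where `P ≡ a` and the integer
`b` is an inverse of `a`; it is meant for `r ≠ 0`. -/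
def intShiftedBinomial (a b : ℤ) (m r : ℕ) : ℤ :=
  Ring.choose ((m : ℤ) - 1) (r - 1) * powWithInverse a b ((m : ℤ) - r)

section

variable {ℓ : ℕ} {hℓ : ℓ.Prime} {q P : ℕ} {a b : ℤ}

theorem zpow_sub_powWithInverse_div_mem (hq : q ≠ 0) (hP : ¬ ℓ ∣ P) (ha : (P : ℤ) ≡ a [ZMOD q])
    (hab : a * b ≡ 1 [ZMOD q]) (e : ℤ) :
    ((P : ℚ) ^ e - (powWithInverse a b e : ℤ)) / q ∈ rationalsAt hℓ := by
  have hqQ : (q : ℚ) ≠ 0 := Nat.cast_ne_zero.2 hq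
  have hunit := isUnitIn_rationalsAt_natCast (hℓ := hℓ) hP
  rw [powWithInverse]
  split_ifs with he
  · lift e to ℕ using he
    obtain ⟨z, hz⟩ := (ha.pow e).symm.dvd
    have hquot : ((P : ℚ) ^ (e : ℤ) - ((a ^ (e : ℤ).toNat : ℤ) : ℚ)) / q = z := by
      rw [Int.toNat_natCast, zpow_natCast, div_eq_iff hqQ, mul_comm]
      exact_mod_cast hz
    exact hquot ▸ intCast_mem _ z
  · obtain ⟨k, rfl⟩ : ∃ k : ℕ, e = -(k : ℤ) := ⟨(-e).toNat, by omega⟩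
    obtain ⟨z, hz⟩ := (((ha.mul_right b).trans hab).pow k).dvd
    have hz' : (1 : ℚ) - ((P : ℚ) * b) ^ k = q * z := by
      rw [one_pow] at hz
      exact_mod_cast hz
    have hquot : ((P : ℚ) ^ (-(k : ℤ)) - ((b ^ (- -(k : ℤ)).toNat : ℤ) : ℚ)) / q =
        (P : ℚ) ^ (-(k : ℤ)) * z := by
      rw [neg_neg, Int.toNat_natCast, div_eq_iff hqQ, mul_assoc, mul_comm (z : ℚ), ← hz', mul_sub,
        mul_one, mul_pow, zpow_neg, zpow_natCast, inv_mul_cancel_left₀ (pow_ne_zero _ hunit.1),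
        Int.cast_pow]
    exact hquot ▸ mul_mem (hunit.zpow_mem _) (intCast_mem _ z)

theorem shiftedBinomial_mem_rationalsAt (hP : ¬ ℓ ∣ P) (m r : ℕ) :
    shiftedBinomial P m r ∈ rationalsAt hℓ := by
  rw [shiftedBinomial]
  split_ifs
  · exact zero_mem _
  · exact mul_mem (intCast_mem _ _) ((isUnitIn_rationalsAt_natCast hP).zpow_mem _)

theorem shiftedBinomial_sub_intShiftedBinomial_div_mem (hq : q ≠ 0) (hP : ¬ ℓ ∣ P)
    (ha : (P : ℤ) ≡ a [ZMOD q]) (hab : a * b ≡ 1 [ZMOD q]) (m : ℕ) {r : ℕ} (hr : r ≠ 0) :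
    (shiftedBinomial P m r - intShiftedBinomial a b m r) / q ∈ rationalsAt hℓ := by
  rw [shiftedBinomial, if_neg hr, intShiftedBinomial, Int.cast_mul, ← mul_sub, mul_div_assoc]
  exact mul_mem (intCast_mem _ _) (zpow_sub_powWithInverse_div_mem hq hP ha hab _)

end

theorem exists_natCast_modEq_and_coprime {q : ℕ} (hq : q ≠ 0) {a : ℤ} (ha : IsCoprime a q) :
    ∃ P : ℕ, (P : ℤ) ≡ a [ZMOD q] ∧ Nat.Coprime q P := by
  have hP : ((a % q).toNat : ℤ) = a % q :=
    Int.toNat_of_nonneg (Int.emod_nonneg a (Nat.cast_ne_zero.2 hq))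
  refine ⟨(a % q).toNat, hP ▸ Int.mod_modEq a q, Nat.isCoprime_iff_coprime.1 ?_⟩
  rw [hP, Int.emod_def, sub_eq_add_neg, ← mul_neg]
  exact ha.symm.add_mul_left_right _

variable {ι : Type*} [Fintype ι] [DecidableEq ι] {N q : ℕ} {c : ℚ} {P r : ι → ℕ} {a b : ι → ℤ}

theorem exists_int_eq_mul_dedekindCoeff (hc : ClearsTodd ι N c) (hq : q ≠ 0)
    (hP : ∀ i, Nat.Coprime q (P i)) (hr : ∑ i, r i = N) (hr0 : ∀ i, r i ≠ 0) :
    ∃ y : ℤ, (y : ℚ) = c * dedekindCoeff q P r := by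
  refine exists_int_eq_of_forall_mem_rationalsAt fun ℓ hℓ => ?_
  by_cases hℓq : ℓ ∣ q
  · have hℓP (i : ι) : ¬ ℓ ∣ P i := fun h => Nat.not_coprime_of_dvd_of_dvd hℓ.one_lt hℓq h (hP i)
    have hcongr := mul_mem (natCast_mem (rationalsAt hℓ) q)
      (mul_dedekindCoeff_add_correctionSum_div_mem_rationalsAt hℓ hc hq hℓq hP hr hr0)
    rw [mul_div_cancel₀ _ (Nat.cast_ne_zero.2 hq), mul_add] at hcongr
    exact (add_mem_cancel_right (hc.mul_correctionSum_mem fun i m =>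
      shiftedBinomial_mem_rationalsAt (hℓP i) m (r i))).1 hcongr
  · exact mul_dedekindCoeff_mem_rationalsAt hℓ hc hℓq P hr

theorem exists_int_eq_neg_mul_correctionSum (hc : ClearsTodd ι N c) (a b : ι → ℤ) (r : ι → ℕ) :
    ∃ z : ℤ, (z : ℚ) =
      -(c * correctionSum N fun i m => (intShiftedBinomial (a i) (b i) m (r i) : ℚ)) := by
  obtain ⟨z, hz⟩ := hc.mul_correctionSum_mem (O := (Int.castRingHom ℚ).range)
    (β := fun i m => (intShiftedBinomial (a i) (b i) m (r i) : ℚ)) fun i m => ⟨_, rfl⟩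
  exact ⟨-z, by rw [Int.cast_neg, ← hz, eq_intCast]⟩

theorem mul_dedekindCoeff_modEq_neg_mul_correctionSum (hc : ClearsTodd ι N c) (hq : q ≠ 0)
    (hP : ∀ i, Nat.Coprime q (P i)) (hr : ∑ i, r i = N) (hr0 : ∀ i, r i ≠ 0)
    (ha : ∀ i, (P i : ℤ) ≡ a i [ZMOD q]) (hab : ∀ i, a i * b i ≡ 1 [ZMOD q]) {y z : ℤ}
    (hy : (y : ℚ) = c * dedekindCoeff q P r)
    (hz : (z : ℚ) =
      -(c * correctionSum N fun i m => (intShiftedBinomial (a i) (b i) m (r i) : ℚ))) :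
    y ≡ z [ZMOD q] := by
  refine intModEq_of_forall_mem_rationalsAt hq fun ℓ hℓ hℓq => ?_
  have hℓP (i : ι) : ¬ ℓ ∣ P i := fun h => Nat.not_coprime_of_dvd_of_dvd hℓ.one_lt hℓq h (hP i)
  have hreplace := hc.mul_correctionSum_sub_div_mem (O := rationalsAt hℓ) (q := q)
    (fun i m => shiftedBinomial_mem_rationalsAt (hℓP i) m (r i))
    (fun i m => intCast_mem _ (intShiftedBinomial (a i) (b i) m (r i)))
    fun i m => shiftedBinomial_sub_intShiftedBinomial_div_mem hq (hℓP i) (ha i) (hab i) m (hr0 i)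
  convert sub_mem (mul_dedekindCoeff_add_correctionSum_div_mem_rationalsAt hℓ hc hq hℓq hP hr hr0)
    hreplace using 1
  rw [Int.cast_sub, hy, hz]
  ring

end Congruence

theorem isCoprime_snoc_neg_one {n q : ℕ} {p : Fin n → ℤ} (hp : ∀ i, IsCoprime (p i) (q : ℤ))
    (i : Fin (n + 1)) : IsCoprime ((Fin.snoc p (-1) : Fin (n + 1) → ℤ) i) (q : ℤ) := by
  cases i using Fin.lastCases with
  | last => simpa using isCoprime_one_left.neg_left
  | cast i => simpa using hp i

theorem snoc_neg_one_mul_snoc_neg_one_modEq {n q : ℕ} {p p' : Fin n → ℤ}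
    (hp' : ∀ i, p i * p' i ≡ 1 [ZMOD (q : ℤ)]) (i : Fin (n + 1)) :
    (Fin.snoc p (-1) : Fin (n + 1) → ℤ) i * (Fin.snoc p' (-1) : Fin (n + 1) → ℤ) i ≡
      1 [ZMOD (q : ℤ)] := by
  cases i using Fin.lastCases with
  | last => simp only [Fin.snoc_last]; rfl
  | cast i => simpa using hp' i

/-- The dimension is `n + 1`, so that `N - n` below is the weight minus the dimension plus one; in
the last line, the tuples `p` and `p'` are extended by the last entry `-1`, its own inverse. -/
theorem mainTheorem1 (n : ℕ) (r : Fin (n + 1) → ℕ) (hr : ∀ i, 1 ≤ r i) (N : ℕ)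
    (hN : N = ∑ i, r i) (q : ℕ) (hq : 1 ≤ q) (p : Fin n → ℤ)
    (hp : ∀ i, IsCoprime (p i) (q : ℤ)) :
    ∃ a : ℤ,
      (a : ℚ) = (toddDenominator N (n + 1) : ℚ) * (q : ℚ) ^ (N - n) *
        generalizedDedekindSum r q p / ∏ i, ((r i).factorial : ℚ) ∧
      ∀ p' : Fin n → ℤ, (∀ i, p i * p' i ≡ 1 [ZMOD (q : ℤ)]) →
        ∃ b : ℤ,
          (b : ℚ) = ∑ m ∈ evenIndices (n + 1) N,
            (-(toddDenominator N (n + 1) : ℚ)) *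
              (∏ i, bernoulli (m i) / ((m i).factorial : ℚ)) *
              ∏ i, ((Ring.choose ((m i : ℤ) - 1) (r i - 1) *
                powWithInverse ((Fin.snoc p (-1) : Fin (n + 1) → ℤ) i)
                  ((Fin.snoc p' (-1) : Fin (n + 1) → ℤ) i) ((m i : ℤ) - (r i : ℤ)) : ℤ) : ℚ) ∧
          a ≡ b [ZMOD (q : ℤ)] := by
  have hq0 : q ≠ 0 := Nat.one_le_iff_ne_zero.1 hq
  have hr0 (i : Fin (n + 1)) : r i ≠ 0 := Nat.one_le_iff_ne_zero.1 (hr i)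
  have hc := clearsTodd_toddDenominator N (n + 1)
  choose P hPp hPq using fun i => exists_natCast_modEq_and_coprime hq0 (isCoprime_snoc_neg_one hp i)
  obtain ⟨a, ha⟩ := exists_int_eq_mul_dedekindCoeff hc hq0 hPq hN.symm hr0
  refine ⟨a, ?_, fun p' hp' => ?_⟩
  · rw [ha, dedekindCoeff_eq_generalizedDedekindSum hq0 hPp hr0, ← hN]
    ring
  · obtain ⟨b, hb⟩ := exists_int_eq_neg_mul_correctionSum hc (Fin.snoc p (-1)) (Fin.snoc p' (-1)) r
    refine ⟨b, ?_, mul_dedekindCoeff_modEq_neg_mul_correctionSum hc hq0 hPq hN.symm hr0 hPp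
      (snoc_neg_one_mul_snoc_neg_one_modEq hp') ha hb⟩
    rw [hb, correctionSum_eq_sum_evenIndices, ← neg_mul, Finset.mul_sum]
    simp only [intShiftedBinomial, mul_assoc]
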